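/- Let $F$ be a field, let $n \ge 3$, and let $H$ be a group that is elementarily equivalent, as a group, to $GL_n(F)$. Write $H'$ for the derived subgroup of $H$ and $Z(H)$ for its center. Then there is a field $L$ such that $L \equiv F$ (as fields), $H' \cong SL_n(L)$ (as groups), and $H$ fits into a short exact sequence of groups $$1 \longrightarrow H' \cdot Z(H) \longrightarrow H \longrightarrow L^\times/(L^\times)^n \longrightarrow 1$$ whose first map is the inclusion, where $(L^\times)^n$ is the subgroup of $n$-th powers of elements of $L^\times$. Moreover, $Z(H) \equiv F^\times$ as groups. Here $\equiv$ denotes elementary equivalence, i.e. satisfying the same first-order sentences, in the language of groups or of rings respectively. -/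

import Mathlib

universe u v

/-- The function symbols of the language of groups: multiplication, inversion and identity. -/
inductive GroupFunc : ℕ → Type
  | mul : GroupFunc 2
  | inv : GroupFunc 1
  | one : GroupFunc 0

/-- The first-order language of groups (equality is a logical symbol). -/
def groupLanguage : FirstOrder.Language where
  Functions := GroupFunc
  Relations := fun _ => Empty

/-- A group, viewed as a structure for the language of groups. -/
@[reducible]
def groupStructure (G : Type*) [Group G] : groupLanguage.Structure G where
  funMap := fun {k} f =>
    match k, f with
    | _, GroupFunc.mul => fun x => x 0 * x 1
    | _, GroupFunc.inv => fun x => (x 0)⁻¹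
    | _, GroupFunc.one => fun _ => 1
  RelMap := fun r _ => r.elim

/-- Two groups are elementarily equivalent: they satisfy the same first-order sentences of the
language of groups. -/
def GroupElemEquiv (G H : Type*) [Group G] [Group H] : Prop :=
  letI := groupStructure G
  letI := groupStructure H
  groupLanguage.ElementarilyEquivalent G H

/-- Two fields are elementarily equivalent: they satisfy the same first-order sentences of the
language of rings. -/
def FieldElemEquiv (K L : Type*) [Field K] [Field L] : Prop :=
  letI := FirstOrder.Ring.compatibleRingOfRing K
  letI := FirstOrder.Ring.compatibleRingOfRing L
  FirstOrder.Language.ring.ElementarilyEquivalent K L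

/-! Commutators of elementary transvections encode the arithmetic of `F` inside `GL_n(F)`; the main
point is to single out the transvections with entry 1 by a formula. `IsRootFrame` lists Steinberg
relations, nontriviality, mutual conjugacy and a condition forcing unipotence. By
`Matrix.exists_mulEquiv_of_isRootFrame`, every tuple in `GL_n(F)` with these properties is the image
of the standard one under a group automorphism: a conjugation, possibly preceded by transpose
inverse. So all such tuples satisfy the same formulas, and a tuple in `H` with these properties
satisfies exactly the formulas of the standard tuple (`GroupElemEquiv.exists_rootFrame`).

This uniqueness rests on rigidity. Unipotent root elements for `d` indices act trivially in
dimension below `d` (`rigidBelow`): the common fixed space of a row is stable under the smaller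
system, induction applies to it and to its quotient, opposite root elements then commute, and the
braid relation makes everything trivial. In dimension exactly `n`, the same argument makes the fixed
space of a row or of a column a hyperplane (`finrank_rowFix`), from which a basis is built
(`exists_basis`).

With the tuple as constants, one root group is definable and is a copy of the field, with addition
from the group and multiplication from a commutator word. The same formulas in `H` give `L`,
elementarily equivalent to `F`. Matrices of determinant one are products of boundedly many
transvections, so facts about them are first-order. For each shape of word, a product of matrices
over `L` is trivial exactly when the corresponding product in `H` is; hence `H'` and `SL_n(L)` are
the same quotient of a free group. The relation "the determinant is `a` up to `n`-th powers" is
definable too and transfers to the map onto the units modulo `n`-th powers. The center is definable,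
which settles the last claim. -/

open FirstOrder FirstOrder.Language
open scoped commutatorElement

universe w x

attribute [local instance] groupStructure

/-! ### Formulas read simultaneously in two groups -/

namespace GroupTerm

variable {V : Type*}

/-- The identity, as a term. -/
def one : groupLanguage.Term V := Term.func (GroupFunc.one : groupLanguage.Functions 0) Fin.elim0

/-- The product of two terms. -/
def mul (s t : groupLanguage.Term V) : groupLanguage.Term V :=
  Term.func (GroupFunc.mul : groupLanguage.Functions 2) ![s, t]

/-- The inverse of a term. -/
def inv (s : groupLanguage.Term V) : groupLanguage.Term V :=
  Term.func (GroupFunc.inv : groupLanguage.Functions 1) ![s]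

variable {G : Type*} [Group G] (v : V → G)

@[simp] lemma realize_one : (one : groupLanguage.Term V).realize v = 1 := rfl

@[simp] lemma realize_mul (s t : groupLanguage.Term V) :
    (mul s t).realize v = s.realize v * t.realize v := rfl

@[simp] lemma realize_inv (s : groupLanguage.Term V) : (inv s).realize v = (s.realize v)⁻¹ := rfl

end GroupTerm

/-- Two groups `G`, `H` with named constants, together with sets `F` and `L` mapped to them; a
common ground for formulas that are read simultaneously on both sides. -/
structure Frame (G H : Type*) [Group G] [Group H] (ι : Type) (F L : Type*) where
  /-- the constants of `G` -/
  constG : ι → G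
  /-- the constants of `H` -/
  constH : ι → H
  /-- the second sort over `G` -/
  embG : F → G
  /-- the second sort over `H` -/
  embH : L → H

namespace Frame

variable {G H : Type*} [Group G] [Group H] {ι : Type} {F L : Type*} (S : Frame G H ι F L)
variable {α β κ : Type}

/-- The assignment of group elements to variables given by a context over `G`. -/
def asgG (γ : (α → G) × (β → F)) : ι ⊕ (α ⊕ β) → G :=
  Sum.elim S.constG (Sum.elim γ.1 (S.embG ∘ γ.2))

/-- The assignment of group elements to variables given by a context over `H`. -/
def asgH (γ : (α → H) × (β → L)) : ι ⊕ (α ⊕ β) → H :=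
  Sum.elim S.constH (Sum.elim γ.1 (S.embH ∘ γ.2))

/-- One formula defines `P` over `G` and `Q` over `H`. -/
def Definable (P : (α → G) × (β → F) → Prop) (Q : (α → H) × (β → L) → Prop) : Prop :=
  ∃ φ : groupLanguage.Formula (ι ⊕ (α ⊕ β)),
    (∀ γ, φ.Realize (S.asgG γ) ↔ P γ) ∧ ∀ γ, φ.Realize (S.asgH γ) ↔ Q γ

/-- One term has the values `f` over `G` and `g` over `H`. -/
def IsTerm (f : (α → G) × (β → F) → G) (g : (α → H) × (β → L) → H) : Prop :=
  ∃ t : groupLanguage.Term (ι ⊕ (α ⊕ β)),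
    (∀ γ, t.realize (S.asgG γ) = f γ) ∧ ∀ γ, t.realize (S.asgH γ) = g γ

/-- The functions `f` and `g` into the second sorts are given by one term. -/
def IsSTerm (f : (α → G) × (β → F) → F) (g : (α → H) × (β → L) → L) : Prop :=
  S.IsTerm (fun γ => S.embG (f γ)) (fun γ => S.embH (g γ))

variable {S}

namespace IsTerm

variable {f f' : (α → G) × (β → F) → G} {g g' : (α → H) × (β → L) → H}

lemma const (i : ι) :
    S.IsTerm (α := α) (β := β) (fun _ => S.constG i) (fun _ => S.constH i) :=
  ⟨.var (.inl i), fun _ => rfl, fun _ => rfl⟩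

lemma var (a : α) :
    S.IsTerm (α := α) (β := β) (fun γ => γ.1 a) (fun γ => γ.1 a) :=
  ⟨.var (.inr (.inl a)), fun _ => rfl, fun _ => rfl⟩

lemma one : S.IsTerm (α := α) (β := β) (fun _ => 1) (fun _ => 1) :=
  ⟨GroupTerm.one, fun _ => rfl, fun _ => rfl⟩

lemma mul (h : S.IsTerm f g) (h' : S.IsTerm f' g') :
    S.IsTerm (fun γ => f γ * f' γ) (fun γ => g γ * g' γ) := by
  obtain ⟨t, h₁, h₂⟩ := h
  obtain ⟨t', h₁', h₂'⟩ := h'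
  exact ⟨GroupTerm.mul t t', fun γ => by simp [h₁, h₁'], fun γ => by simp [h₂, h₂']⟩

lemma inv (h : S.IsTerm f g) : S.IsTerm (fun γ => (f γ)⁻¹) (fun γ => (g γ)⁻¹) := by
  obtain ⟨t, h₁, h₂⟩ := h
  exact ⟨GroupTerm.inv t, fun γ => by simp [h₁], fun γ => by simp [h₂]⟩

lemma commutator (h : S.IsTerm f g) (h' : S.IsTerm f' g') :
    S.IsTerm (fun γ => ⁅f γ, f' γ⁆) (fun γ => ⁅g γ, g' γ⁆) := by
  simp only [commutatorElement_def]
  exact ((h.mul h').mul h.inv).mul h'.inv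

lemma pow (h : S.IsTerm f g) (k : ℕ) :
    S.IsTerm (fun γ => f γ ^ k) (fun γ => g γ ^ k) := by
  induction k with
  | zero => simpa using one
  | succ k ih => simpa only [pow_succ] using ih.mul h

lemma listProd {k : ℕ} {f : Fin k → (α → G) × (β → F) → G} {g : Fin k → (α → H) × (β → L) → H}
    (h : ∀ i, S.IsTerm (f i) (g i)) :
    S.IsTerm (fun γ => (List.ofFn fun i => f i γ).prod)
      (fun γ => (List.ofFn fun i => g i γ).prod) := by
  induction k with
  | zero => simpa using one
  | succ k ih =>
    simp only [List.ofFn_succ, List.prod_cons]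
    exact (h 0).mul (ih fun i => h i.succ)

end IsTerm

lemma IsSTerm.var (b : β) :
    S.IsSTerm (α := α) (β := β) (fun γ => γ.2 b) (fun γ => γ.2 b) :=
  ⟨.var (.inr (.inr b)), fun _ => rfl, fun _ => rfl⟩

namespace Definable

variable {P P' : (α → G) × (β → F) → Prop} {Q Q' : (α → H) × (β → L) → Prop}

lemma congr (h : S.Definable P Q) (hP : ∀ γ, P γ ↔ P' γ) (hQ : ∀ γ, Q γ ↔ Q' γ) :
    S.Definable P' Q' := by
  obtain ⟨φ, h₁, h₂⟩ := h
  exact ⟨φ, fun γ => (h₁ γ).trans (hP γ), fun γ => (h₂ γ).trans (hQ γ)⟩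

lemma eq {f f' : (α → G) × (β → F) → G} {g g' : (α → H) × (β → L) → H}
    (h : S.IsTerm f g) (h' : S.IsTerm f' g') :
    S.Definable (fun γ => f γ = f' γ) (fun γ => g γ = g' γ) := by
  obtain ⟨t, h₁, h₂⟩ := h
  obtain ⟨t', h₁', h₂'⟩ := h'
  exact ⟨t.equal t', fun γ => by simp [Formula.realize_equal, h₁, h₁'],
    fun γ => by simp [Formula.realize_equal, h₂, h₂']⟩

lemma sEq (hG : Function.Injective S.embG) (hH : Function.Injective S.embH)
    {f f' : (α → G) × (β → F) → F} {g g' : (α → H) × (β → L) → L}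
    (h : S.IsSTerm f g) (h' : S.IsSTerm f' g') :
    S.Definable (fun γ => f γ = f' γ) (fun γ => g γ = g' γ) :=
  (eq h h').congr (fun _ => hG.eq_iff) (fun _ => hH.eq_iff)

lemma not (h : S.Definable P Q) : S.Definable (fun γ => ¬ P γ) (fun γ => ¬ Q γ) := by
  obtain ⟨φ, h₁, h₂⟩ := h
  exact ⟨∼φ, fun γ => by simp [h₁], fun γ => by simp [h₂]⟩

lemma imp (h : S.Definable P Q) (h' : S.Definable P' Q') :
    S.Definable (fun γ => P γ → P' γ) (fun γ => Q γ → Q' γ) := by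
  obtain ⟨φ, h₁, h₂⟩ := h
  obtain ⟨φ', h₁', h₂'⟩ := h'
  exact ⟨φ.imp φ', fun γ => by simp [h₁, h₁'], fun γ => by simp [h₂, h₂']⟩

lemma and (h : S.Definable P Q) (h' : S.Definable P' Q') :
    S.Definable (fun γ => P γ ∧ P' γ) (fun γ => Q γ ∧ Q' γ) := by
  obtain ⟨φ, h₁, h₂⟩ := h
  obtain ⟨φ', h₁', h₂'⟩ := h'
  exact ⟨φ ⊓ φ', fun γ => by simp [h₁, h₁'], fun γ => by simp [h₂, h₂']⟩

lemma iff (h : S.Definable P Q) (h' : S.Definable P' Q') :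
    S.Definable (fun γ => P γ ↔ P' γ) (fun γ => Q γ ↔ Q' γ) :=
  ((h.imp h').and (h'.imp h)).congr (fun _ => iff_iff_implies_and_implies.symm)
    (fun _ => iff_iff_implies_and_implies.symm)

/-- Conditions on indices, such as `i ≠ j`, are not about group elements; they enter formulas as the
constants true and false. -/
lemma prop (p : Prop) : S.Definable (α := α) (β := β) (fun _ => p) (fun _ => p) := by
  by_cases hp : p
  · exact ⟨⊤, fun γ => by simp [hp], fun γ => by simp [hp]⟩
  · exact ⟨⊥, fun γ => by simp [hp], fun γ => by simp [hp]⟩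

/-- A quantifier over a finite index set outside the structure is a finite conjunction, not a
quantifier of the language. -/
lemma all [Finite κ] {P : κ → (α → G) × (β → F) → Prop} {Q : κ → (α → H) × (β → L) → Prop}
    (h : ∀ k, S.Definable (P k) (Q k)) :
    S.Definable (fun γ => ∀ k, P k γ) (fun γ => ∀ k, Q k γ) := by
  choose φ h₁ h₂ using h
  exact ⟨Formula.iInf φ, fun γ => by simp [h₁], fun γ => by simp [h₂]⟩

lemma ex [Finite κ] {P : κ → (α → G) × (β → F) → Prop} {Q : κ → (α → H) × (β → L) → Prop}
    (h : ∀ k, S.Definable (P k) (Q k)) :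
    S.Definable (fun γ => ∃ k, P k γ) (fun γ => ∃ k, Q k γ) :=
  (not (all fun k => (h k).not)).congr (fun _ => by simp) (fun _ => by simp)

/-- Quantification over finite tuples of group elements. -/
lemma allTuple [Finite κ] {P : (α → G) × (β → F) → (κ → G) → Prop}
    {Q : (α → H) × (β → L) → (κ → H) → Prop}
    (h : S.Definable (α := α ⊕ κ) (fun γ => P (fun a => γ.1 (.inl a), γ.2) fun k => γ.1 (.inr k))
      (fun γ => Q (fun a => γ.1 (.inl a), γ.2) fun k => γ.1 (.inr k))) :
    S.Definable (fun γ => ∀ x, P γ x) (fun γ => ∀ x, Q γ x) := by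
  obtain ⟨φ, h₁, h₂⟩ := h
  let r : ι ⊕ ((α ⊕ κ) ⊕ β) → (ι ⊕ (α ⊕ β)) ⊕ κ := Sum.elim (fun i => .inl (.inl i))
    (Sum.elim (Sum.elim (fun a => .inl (.inr (.inl a))) .inr) (fun b => .inl (.inr (.inr b))))
  refine ⟨(φ.relabel r).iAlls κ, fun γ => ?_, fun γ => ?_⟩
  · rw [Formula.realize_iAlls]
    refine forall_congr' fun x => ?_
    rw [Formula.realize_relabel]
    refine Iff.trans (iff_of_eq (congrArg _ ?_)) (h₁ (Sum.elim γ.1 x, γ.2))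
    ext (i | (a | k) | b) <;> rfl
  · rw [Formula.realize_iAlls]
    refine forall_congr' fun x => ?_
    rw [Formula.realize_relabel]
    refine Iff.trans (iff_of_eq (congrArg _ ?_)) (h₂ (Sum.elim γ.1 x, γ.2))
    ext (i | (a | k) | b) <;> rfl

lemma exTuple [Finite κ] {P : (α → G) × (β → F) → (κ → G) → Prop}
    {Q : (α → H) × (β → L) → (κ → H) → Prop}
    (h : S.Definable (α := α ⊕ κ) (fun γ => P (fun a => γ.1 (.inl a), γ.2) fun k => γ.1 (.inr k))
      (fun γ => Q (fun a => γ.1 (.inl a), γ.2) fun k => γ.1 (.inr k))) :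
    S.Definable (fun γ => ∃ x, P γ x) (fun γ => ∃ x, Q γ x) :=
  (not (allTuple (P := fun γ x => ¬ P γ x) (Q := fun γ x => ¬ Q γ x) h.not)).congr
    (fun _ => by simp) (fun _ => by simp)

lemma forallG {P : (α → G) × (β → F) → G → Prop} {Q : (α → H) × (β → L) → H → Prop}
    (h : S.Definable (α := α ⊕ Unit)
      (fun γ => P (fun a => γ.1 (.inl a), γ.2) (γ.1 (.inr ())))
      (fun γ => Q (fun a => γ.1 (.inl a), γ.2) (γ.1 (.inr ())))) :
    S.Definable (fun γ => ∀ x, P γ x) (fun γ => ∀ x, Q γ x) :=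
  (allTuple (κ := Unit) (P := fun γ x => P γ (x ())) (Q := fun γ x => Q γ (x ())) h).congr
    (fun _ => ⟨fun h x => h fun _ => x, fun h x => h (x ())⟩)
    (fun _ => ⟨fun h x => h fun _ => x, fun h x => h (x ())⟩)

lemma existsG {P : (α → G) × (β → F) → G → Prop} {Q : (α → H) × (β → L) → H → Prop}
    (h : S.Definable (α := α ⊕ Unit)
      (fun γ => P (fun a => γ.1 (.inl a), γ.2) (γ.1 (.inr ())))
      (fun γ => Q (fun a => γ.1 (.inl a), γ.2) (γ.1 (.inr ())))) :
    S.Definable (fun γ => ∃ x, P γ x) (fun γ => ∃ x, Q γ x) :=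
  (not (forallG (P := fun γ x => ¬ P γ x) (Q := fun γ x => ¬ Q γ x) h.not)).congr
    (fun _ => by simp) (fun _ => by simp)

end Definable

variable (S) in
/-- The second sorts are definable subsets. -/
structure Sorted : Prop where
  injG : Function.Injective S.embG
  injH : Function.Injective S.embH
  range : S.Definable (α := Unit) (β := Empty) (fun γ => γ.1 () ∈ Set.range S.embG)
    (fun γ => γ.1 () ∈ Set.range S.embH)

namespace Definable

/-- Quantification over finite tuples of elements of the second sort. -/
lemma allSTuple (hS : S.Sorted) [Finite κ] {P : (α → G) × (β → F) → (κ → F) → Prop}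
    {Q : (α → H) × (β → L) → (κ → L) → Prop}
    (h : S.Definable (β := β ⊕ κ) (fun γ => P (γ.1, fun b => γ.2 (.inl b)) fun k => γ.2 (.inr k))
      (fun γ => Q (γ.1, fun b => γ.2 (.inl b)) fun k => γ.2 (.inr k))) :
    S.Definable (fun γ => ∀ x, P γ x) (fun γ => ∀ x, Q γ x) := by
  obtain ⟨φ, h₁, h₂⟩ := h
  obtain ⟨δ, d₁, d₂⟩ := hS.range
  let r : ι ⊕ (α ⊕ (β ⊕ κ)) → (ι ⊕ (α ⊕ β)) ⊕ κ := Sum.elim (fun i => .inl (.inl i))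
    (Sum.elim (fun a => .inl (.inr (.inl a))) (Sum.elim (fun b => .inl (.inr (.inr b))) .inr))
  let s (k : κ) : ι ⊕ (Unit ⊕ Empty) → (ι ⊕ (α ⊕ β)) ⊕ κ := Sum.elim (fun i => .inl (.inl i))
    (Sum.elim (fun _ => .inr k) Empty.elim)
  -- The quantifier over group elements is relativized to the formula `δ` that defines the second
  -- sort.
  refine ⟨((Formula.iInf fun k => δ.relabel (s k)).imp (φ.relabel r)).iAlls κ,
    fun γ => ?_, fun γ => ?_⟩
  · rw [Formula.realize_iAlls]
    simp only [Formula.realize_imp, Formula.realize_iInf, Formula.realize_relabel]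
    have key (x : κ → F) : φ.Realize (Sum.elim (S.asgG γ) (S.embG ∘ x) ∘ r) ↔ P γ x := by
      refine Iff.trans (iff_of_eq (congrArg _ ?_)) (h₁ (γ.1, Sum.elim γ.2 x))
      ext (i | a | (b | k)) <;> rfl
    have dom (x : κ → G) (k : κ) :
        δ.Realize (Sum.elim (S.asgG γ) x ∘ s k) ↔ x k ∈ Set.range S.embG := by
      refine Iff.trans (iff_of_eq (congrArg _ ?_)) (d₁ (fun _ => x k, Empty.elim))
      ext (i | a | b)
      exacts [rfl, rfl, b.elim]
    refine ⟨fun h x => (key x).1 (h _ fun k => (dom _ k).2 ⟨x k, rfl⟩), fun h x hx => ?_⟩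
    choose y hy using fun k => (dom _ k).1 (hx k)
    rw [← (funext hy : S.embG ∘ y = x)]
    exact (key y).2 (h y)
  · rw [Formula.realize_iAlls]
    simp only [Formula.realize_imp, Formula.realize_iInf, Formula.realize_relabel]
    have key (x : κ → L) : φ.Realize (Sum.elim (S.asgH γ) (S.embH ∘ x) ∘ r) ↔ Q γ x := by
      refine Iff.trans (iff_of_eq (congrArg _ ?_)) (h₂ (γ.1, Sum.elim γ.2 x))
      ext (i | a | (b | k)) <;> rfl
    have dom (x : κ → H) (k : κ) :
        δ.Realize (Sum.elim (S.asgH γ) x ∘ s k) ↔ x k ∈ Set.range S.embH := by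
      refine Iff.trans (iff_of_eq (congrArg _ ?_)) (d₂ (fun _ => x k, Empty.elim))
      ext (i | a | b)
      exacts [rfl, rfl, b.elim]
    refine ⟨fun h x => (key x).1 (h _ fun k => (dom _ k).2 ⟨x k, rfl⟩), fun h x hx => ?_⟩
    choose y hy using fun k => (dom _ k).1 (hx k)
    rw [← (funext hy : S.embH ∘ y = x)]
    exact (key y).2 (h y)

lemma exSTuple (hS : S.Sorted) [Finite κ] {P : (α → G) × (β → F) → (κ → F) → Prop}
    {Q : (α → H) × (β → L) → (κ → L) → Prop}
    (h : S.Definable (β := β ⊕ κ) (fun γ => P (γ.1, fun b => γ.2 (.inl b)) fun k => γ.2 (.inr k))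
      (fun γ => Q (γ.1, fun b => γ.2 (.inl b)) fun k => γ.2 (.inr k))) :
    S.Definable (fun γ => ∃ x, P γ x) (fun γ => ∃ x, Q γ x) :=
  (not (allSTuple hS (P := fun γ x => ¬ P γ x) (Q := fun γ x => ¬ Q γ x) h.not)).congr
    (fun _ => by simp) (fun _ => by simp)

lemma forallS (hS : S.Sorted) {P : (α → G) × (β → F) → F → Prop}
    {Q : (α → H) × (β → L) → L → Prop}
    (h : S.Definable (β := β ⊕ Unit)
      (fun γ => P (γ.1, fun b => γ.2 (.inl b)) (γ.2 (.inr ())))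
      (fun γ => Q (γ.1, fun b => γ.2 (.inl b)) (γ.2 (.inr ())))) :
    S.Definable (fun γ => ∀ x, P γ x) (fun γ => ∀ x, Q γ x) :=
  (allSTuple hS (κ := Unit) (P := fun γ x => P γ (x ())) (Q := fun γ x => Q γ (x ())) h).congr
    (fun _ => ⟨fun h x => h fun _ => x, fun h x => h (x ())⟩)
    (fun _ => ⟨fun h x => h fun _ => x, fun h x => h (x ())⟩)

lemma existsS (hS : S.Sorted) {P : (α → G) × (β → F) → F → Prop}
    {Q : (α → H) × (β → L) → L → Prop}
    (h : S.Definable (β := β ⊕ Unit)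
      (fun γ => P (γ.1, fun b => γ.2 (.inl b)) (γ.2 (.inr ())))
      (fun γ => Q (γ.1, fun b => γ.2 (.inl b)) (γ.2 (.inr ())))) :
    S.Definable (fun γ => ∃ x, P γ x) (fun γ => ∃ x, Q γ x) :=
  (not (forallS hS (P := fun γ x => ¬ P γ x) (Q := fun γ x => ¬ Q γ x) h.not)).congr
    (fun _ => by simp) (fun _ => by simp)

end Definable

variable (S) in
/-- The two groups satisfy the same formulas at the constants. -/
def Equivalent : Prop :=
  ∀ φ : groupLanguage.Formula ι, φ.Realize S.constG ↔ φ.Realize S.constH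

/-- A closed statement holds over `G` if and only if it holds over `H`. -/
lemma Equivalent.iff (hS : S.Equivalent) {p q : Prop}
    (h : S.Definable (α := Empty) (β := Empty) (fun _ => p) (fun _ => q)) : p ↔ q := by
  obtain ⟨φ, h₁, h₂⟩ := h
  have := hS (φ.relabel (Sum.elim id (Sum.elim Empty.elim Empty.elim)))
  rw [Formula.realize_relabel, Formula.realize_relabel] at this
  refine (h₁ (Empty.elim, Empty.elim)).symm.trans (Iff.trans ?_ (h₂ (Empty.elim, Empty.elim)))
  convert this using 2 <;> ext (i | a | a) <;> first | rfl | exact a.elim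

/-! ### Interpreted structures -/

/-- Terms of another language whose function symbols are interpreted by group terms. -/
lemma isSTerm_realize {ℒ : Language} [ℒ.Structure F] [ℒ.Structure L]
    (hf : ∀ (k : ℕ) (f : ℒ.Functions k), S.IsSTerm (α := Empty) (β := Fin k)
      (fun γ => Structure.funMap f γ.2) (fun γ => Structure.funMap f γ.2))
    {V : Type} (t : ℒ.Term V) (r : V → β) :
    S.IsSTerm (α := α) (β := β) (fun γ => t.realize (γ.2 ∘ r)) (fun γ => t.realize (γ.2 ∘ r)) := by
  induction t with
  | var i => exact IsSTerm.var (r i)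
  | @func k f ts ih =>
    choose u hu₁ hu₂ using ih
    obtain ⟨t, ht₁, ht₂⟩ := hf k f
    refine ⟨t.subst (Sum.elim (fun i => .var (.inl i)) (Sum.elim Empty.elim u)),
      fun γ => ?_, fun γ => ?_⟩
    · rw [Term.realize_subst]
      refine Eq.trans ?_ (ht₁ (Empty.elim, fun i => (ts i).realize (γ.2 ∘ r)))
      refine congrArg (fun v => t.realize v) (funext ?_)
      rintro (i | a | b)
      exacts [rfl, a.elim, hu₁ b γ]
    · rw [Term.realize_subst]
      refine Eq.trans ?_ (ht₂ (Empty.elim, fun i => (ts i).realize (γ.2 ∘ r)))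
      refine congrArg (fun v => t.realize v) (funext ?_)
      rintro (i | a | b)
      exacts [rfl, a.elim, hu₂ b γ]

lemma Definable.relabelS {P : (α → G) × (β → F) → Prop} {Q : (α → H) × (β → L) → Prop}
    (h : S.Definable P Q) {β' : Type} (r : β → β') :
    S.Definable (fun γ => P (γ.1, γ.2 ∘ r)) (fun γ => Q (γ.1, γ.2 ∘ r)) := by
  obtain ⟨φ, h₁, h₂⟩ := h
  refine ⟨φ.relabel (Sum.map id (Sum.map id r)), fun γ => ?_, fun γ => ?_⟩
  · rw [Formula.realize_relabel]
    refine Iff.trans (iff_of_eq (congrArg _ ?_)) (h₁ _)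
    ext (i | a | b) <;> rfl
  · rw [Formula.realize_relabel]
    refine Iff.trans (iff_of_eq (congrArg _ ?_)) (h₂ _)
    ext (i | a | b) <;> rfl

/-- Formulas of an interpreted language are definable. -/
lemma definable_realize (hS : S.Sorted) {ℒ : Language} [ℒ.Structure F] [ℒ.Structure L]
    (hR : ∀ k, IsEmpty (ℒ.Relations k))
    (hf : ∀ (k : ℕ) (f : ℒ.Functions k), S.IsSTerm (α := Empty) (β := Fin k)
      (fun γ => Structure.funMap f γ.2) (fun γ => Structure.funMap f γ.2))
    {k : ℕ} (φ : ℒ.BoundedFormula Empty k) :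
    S.Definable (α := Empty) (β := Fin k) (fun γ => φ.Realize Empty.elim γ.2)
      (fun γ => φ.Realize Empty.elim γ.2) := by
  induction φ with
  | falsum => exact Definable.prop False
  | @equal k s t =>
    have key (t : ℒ.Term (Empty ⊕ Fin k)) := isSTerm_realize (α := Empty) hf t
      (Sum.elim Empty.elim id)
    refine (Definable.sEq hS.injG hS.injH (key s) (key t)).congr (fun γ => ?_) (fun γ => ?_)
    all_goals
      have : γ.2 ∘ Sum.elim Empty.elim id = Sum.elim Empty.elim γ.2 := by
        ext (a | b)
        exacts [a.elim, rfl]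
      simp only [this]
      rfl
  | rel R => exact ((hR _).false R).elim
  | imp _ _ h h' => exact h.imp h'
  | @all k φ ih =>
    have := ih.relabelS (Fin.snoc (α := fun _ => Fin k ⊕ Unit) Sum.inl (Sum.inr ()))
    refine (Definable.forallS hS (P := fun γ x => φ.Realize Empty.elim (Fin.snoc γ.2 x))
      (Q := fun γ x => φ.Realize Empty.elim (Fin.snoc γ.2 x)) ?_).congr (fun _ => Iff.rfl)
        (fun _ => Iff.rfl)
    refine this.congr (fun γ => iff_of_eq (congrArg _ ?_)) (fun γ => iff_of_eq (congrArg _ ?_)) <;>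
    · ext i
      refine Fin.lastCases ?_ (fun i => ?_) i <;> simp

/-- Interpreted structures in equivalent groups are elementarily equivalent. -/
theorem elementarilyEquivalent (hE : S.Equivalent) (hS : S.Sorted) {ℒ : Language}
    [ℒ.Structure F] [ℒ.Structure L] (hR : ∀ k, IsEmpty (ℒ.Relations k))
    (hf : ∀ (k : ℕ) (f : ℒ.Functions k), S.IsSTerm (α := Empty) (β := Fin k)
      (fun γ => Structure.funMap f γ.2) (fun γ => Structure.funMap f γ.2)) :
    ℒ.ElementarilyEquivalent F L := by
  refine elementarilyEquivalent_iff.2 fun φ => hE.iff ?_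
  have := (definable_realize hS hR hf φ).relabelS (Fin.elim0 : Fin 0 → Empty)
  refine this.congr (fun γ => ?_) (fun γ => ?_) <;>
  · refine iff_of_eq ?_
    unfold Sentence.Realize Formula.Realize
    congr 1 <;> exact Subsingleton.elim _ _

end Frame

/-! ### Steinberg relations -/

/-- Elements of a group that satisfy the relations between elementary transvections. -/
structure IsSteinbergSystem {ι Γ : Type*} [Group Γ] (e : ι → ι → Γ) : Prop where
  comm {i j k l : ι} : i ≠ j → k ≠ l → j ≠ k → i ≠ l → Commute (e i j) (e k l)
  mul {i j k : ι} : i ≠ j → j ≠ k → i ≠ k → ⁅e i j, e j k⁆ = e i k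
  braid {i j : ι} : i ≠ j → e i j * (e j i)⁻¹ * e i j = (e j i)⁻¹ * e i j * (e j i)⁻¹

namespace IsSteinbergSystem

section Group

variable {ι Γ Γ' : Type*} [Group Γ] [Group Γ'] {e : ι → ι → Γ}

lemma map (h : IsSteinbergSystem e) (f : Γ →* Γ') : IsSteinbergSystem fun i j => f (e i j) where
  comm h₁ h₂ h₃ h₄ := (h.comm h₁ h₂ h₃ h₄).map f
  mul h₁ h₂ h₃ := by rw [← map_commutatorElement, h.mul h₁ h₂ h₃]
  braid hij := by simpa using congrArg f (h.braid hij)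

lemma comp (h : IsSteinbergSystem e) {κ : Type*} {r : κ → ι} (hr : Function.Injective r) :
    IsSteinbergSystem fun i j => e (r i) (r j) where
  comm h₁ h₂ h₃ h₄ := h.comm (hr.ne h₁) (hr.ne h₂) (hr.ne h₃) (hr.ne h₄)
  mul h₁ h₂ h₃ := h.mul (hr.ne h₁) (hr.ne h₂) (hr.ne h₃)
  braid hij := h.braid (hr.ne hij)

lemma mul_mul (h : IsSteinbergSystem e) {i j k : ι} (h₁ : i ≠ j) (h₂ : j ≠ k) (h₃ : i ≠ k) :
    e i j * e j k = e i k * e j k * e i j := by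
  rw [← h.mul h₁ h₂ h₃, commutatorElement_def]
  group

/-- The system with the roles of rows and columns exchanged. -/
lemma dual (h : IsSteinbergSystem e) : IsSteinbergSystem fun i j => (e j i)⁻¹ where
  comm h₁ h₂ h₃ h₄ := (h.comm h₁.symm h₂.symm h₄ h₃).inv_inv
  mul {i j k} h₁ h₂ h₃ := by
    have h₄ := h.mul_mul h₂.symm h₁.symm h₃.symm
    have h₅ : Commute (e k i) (e j i * e k j) :=
      (h.comm h₃.symm h₁.symm h₁ h₃.symm).mul_right (h.comm h₃.symm h₂.symm h₃ h₂.symm)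
    have h₆ : Commute (e k i) (e j i * e k j) := h₅
    rw [commutatorElement_def, inv_inv, inv_inv, ← mul_inv_rev, h₄, mul_assoc, mul_assoc,
      h₅.eq, mul_inv_rev, mul_assoc, inv_mul_cancel, mul_one]
  braid hij := by simpa using (h.braid hij).symm

variable (hι : ∀ i j : ι, ∃ k, k ≠ i ∧ k ≠ j)
include hι

/-- Triviality spreads along rows and columns, because each root element is a commutator with any
other in its row or column as a factor. -/
lemma eq_one_of_eq_one (h : IsSteinbergSystem e) {i j : ι} (hij : i ≠ j) (h1 : e i j = 1) :
    ∀ k l, k ≠ l → e k l = 1 := by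
  have row {i j} (hij : i ≠ j) (h1 : e i j = 1) (k : ι) (hk : k ≠ i) : e i k = 1 := by
    by_cases hjk : j = k
    · exact hjk ▸ h1
    · rw [← h.mul hij hjk hk.symm, h1, commutatorElement_one_left]
  have col {i j} (hij : i ≠ j) (h1 : e i j = 1) (k : ι) (hk : k ≠ j) : e k j = 1 := by
    by_cases hik : i = k
    · exact hik ▸ h1
    · rw [← h.mul (Ne.symm hik) hij hk, h1, commutatorElement_one_right]
  intro k l hkl
  -- The path from `(i, j)` along the row and then along a column passes through `(i, l)`. This is
  -- not a root if `i = l`, and a third index gives a detour.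
  by_cases hil : i = l
  · subst hil
    obtain ⟨m, hmi, hmk⟩ := hι i k
    exact row hmk.symm (col hmi.symm (row hij h1 m hmi) k hmk.symm) i hkl.symm
  · exact col hil (row hij h1 l (Ne.symm hil)) k hkl

/-- If opposite elements commute, the braid relation reduces to `e i j = (e j i)⁻¹`. The right side
commutes with `e k i`, so the commutator `e k j` of `e k i` and `e i j` is trivial. -/
lemma eq_one_of_commute (h : IsSteinbergSystem e) {i j : ι} (hij : i ≠ j)
    (hc : Commute (e i j) (e j i)) : ∀ k l, k ≠ l → e k l = 1 := by
  have hc' : Commute (e i j) (e j i)⁻¹ := hc.inv_right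
  have heq : e i j = (e j i)⁻¹ := mul_left_cancel ((h.braid hij).trans (by rw [hc'.eq]))
  obtain ⟨k, hki, hkj⟩ := hι i j
  refine h.eq_one_of_eq_one hι hkj ?_
  rw [← h.mul hki hij hkj, heq, commutatorElement_eq_one_iff_commute]
  exact (h.comm hki hij.symm hij hki).inv_right

end Group

/-! ### Rigidity of unipotent representations -/

section Representation

variable {ι : Type x} {Γ : Type v} {F : Type u} {V : Type w} [Group Γ] [Field F] [AddCommGroup V]
  [Module F V]
  {e : ι → ι → Γ} {ρ : Representation F Γ V}

lemma map_eq_one_iff_toHomUnits (ρ : Representation F Γ V) (g : Γ) :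
    MonoidHom.toHomUnits ρ g = 1 ↔ ρ g = 1 := by
  rw [Units.ext_iff]
  rfl

/-- If opposite root elements act trivially on a subspace and on its quotient, the action is
trivial. -/
lemma rep_eq_one_of_flag (hι : ∀ i j : ι, ∃ k, k ≠ i ∧ k ≠ j) (h : IsSteinbergSystem e)
    {i j : ι} (hij : i ≠ j) (W : Submodule F V)
    (h₁ : ∀ w ∈ W, ρ (e i j) w = w) (h₂ : ∀ w ∈ W, ρ (e j i) w = w)
    (h₃ : ∀ v, ρ (e i j) v - v ∈ W) (h₄ : ∀ v, ρ (e j i) v - v ∈ W) :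
    ∀ k l, k ≠ l → ρ (e k l) = 1 := by
  have := (h.map (MonoidHom.toHomUnits ρ)).eq_one_of_commute hι hij (by
    rw [Commute, SemiconjBy, Units.ext_iff]
    ext v
    change ρ (e i j) (ρ (e j i) v) = ρ (e j i) (ρ (e i j) v)
    have h₅ := h₁ _ (h₄ v)
    have h₆ := h₂ _ (h₃ v)
    rw [map_sub] at h₅ h₆
    rw [sub_eq_iff_eq_add.1 h₅, sub_eq_iff_eq_add.1 h₆]
    abel)
  exact fun k l hkl => (map_eq_one_iff_toHomUnits ρ _).1 (this k l hkl)

/-- Commuting unipotent operators on a nonzero space have a common fixed vector. -/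
lemma exists_common_fixed {κ : Type*} [FiniteDimensional F V] [Nontrivial V]
    (N : κ → Module.End F V) (hN : ∀ k, IsNilpotent (N k)) (hc : ∀ k l, Commute (N k) (N l)) :
    ∃ v ≠ 0, ∀ k, N k v = 0 := by
  -- Take a nonzero invariant subspace of least dimension. The kernel of each `N k` on it is
  -- nonzero, and invariant by commutativity, hence everything.
  let P (d : ℕ) := ∃ U : Submodule F V, U ≠ ⊥ ∧ (∀ k, ∀ v ∈ U, N k v ∈ U) ∧ Module.finrank F U = d
  have hP : ∃ d, P d := ⟨_, ⊤, top_ne_bot, fun _ _ _ => trivial, rfl⟩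
  classical
  obtain ⟨U, hU, hst, hd⟩ := Nat.find_spec hP
  obtain ⟨v, hv, hv0⟩ := U.ne_bot_iff.1 hU
  refine ⟨v, hv0, fun k => ?_⟩
  suffices U ⊓ LinearMap.ker (N k) = U from (inf_eq_left.1 this hv)
  refine Submodule.eq_of_le_of_finrank_le inf_le_left ?_
  rw [hd]
  refine Nat.find_min' hP ⟨_, ?_, ?_, rfl⟩
  · obtain ⟨m, hm⟩ := hN k
    have hex : ∃ m, ((N k) ^ m) v = 0 := ⟨m, by rw [hm]; rfl⟩
    have h0 : Nat.find hex ≠ 0 := fun h0 => hv0 (by simpa [h0] using Nat.find_spec hex)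
    obtain ⟨m, hm⟩ := Nat.exists_eq_succ_of_ne_zero h0
    refine (Submodule.ne_bot_iff _).2 ⟨((N k) ^ m) v, ⟨?_, ?_⟩, Nat.find_min hex (by omega)⟩
    · clear hm
      induction m with
      | zero => simpa
      | succ m ih => rw [pow_succ']; exact hst k _ ih
    · have := Nat.find_spec hex
      rw [hm, pow_succ'] at this
      exact this
  · rintro l v ⟨hv, hk⟩
    refine ⟨hst l v hv, ?_⟩
    have : N k (N l v) = N l (N k v) := congrArg (· v) (hc k l).eq
    rw [SetLike.mem_coe, LinearMap.mem_ker, this, LinearMap.mem_ker.1 hk, map_zero]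

/-- In dimension below `d`, root elements indexed by `κ` that act unipotently act trivially. -/
def _root_.RigidBelow (F : Type u) [Field F] (κ : Type x) (d : ℕ) : Prop :=
  ∀ (Γ : Type v) [Group Γ] (V : Type w) [AddCommGroup V] [Module F V] [FiniteDimensional F V]
    (e : κ → κ → Γ) (ρ : Representation F Γ V), IsSteinbergSystem e →
    (∀ i j, i ≠ j → IsNilpotent (ρ (e i j) - 1)) → Module.finrank F V < d →
    ∀ i j, i ≠ j → ρ (e i j) = 1

/-- The elements that leave a subspace invariant. -/
def _root_.Representation.setStabilizer (ρ : Representation F Γ V) (W : Submodule F V) :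
    Subgroup Γ where
  carrier := {g | W ≤ W.comap (ρ g) ∧ W ≤ W.comap (ρ g⁻¹)}
  one_mem' := by simp [SetLike.le_def]
  mul_mem' {a b} ha hb := by
    refine ⟨fun w hw => ?_, fun w hw => ?_⟩
    · simpa using ha.1 (hb.1 hw)
    · simpa using hb.2 (ha.2 hw)
  inv_mem' {a} ha := ⟨ha.2, by simpa using ha.1⟩

/-- An injective map of a finite-dimensional space into itself is onto, so invariance under `g`
implies invariance under `g⁻¹`. -/
lemma _root_.Representation.mem_setStabilizer [FiniteDimensional F V] {W : Submodule F V} {g : Γ}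
    (h : ∀ w ∈ W, ρ g w ∈ W) : g ∈ ρ.setStabilizer W := by
  refine ⟨h, ?_⟩
  have hinj : Function.Injective (ρ g) := (ρ.apply_bijective g).1
  have : W.map (ρ g) = W :=
    Submodule.eq_of_le_of_finrank_eq (Submodule.map_le_iff_le_comap.2 h)
      (LinearEquiv.finrank_eq (Submodule.equivMapOfInjective (ρ g) hinj W)).symm
  intro w hw
  rw [← this] at hw
  obtain ⟨w', hw', rfl⟩ := hw
  simpa using hw'

variable {i₀ : ι} {d : ℕ} [FiniteDimensional F V] {W : Submodule F V}

variable {κ : Type x} {r : κ → ι}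

open scoped Classical in
variable (e r) in
/-- The root elements with indices in the range of `r`, in a subgroup that contains them. -/
noncomputable def restrict (Δ : Subgroup Γ) (hΔ : ∀ i j, r i ≠ r j → e (r i) (r j) ∈ Δ)
    (i j : κ) : Δ :=
  -- Diagonal elements are unconstrained and need not lie in `Δ`; the relations never mention them.
  if h : r i = r j then 1 else ⟨e (r i) (r j), hΔ i j h⟩

omit [FiniteDimensional F V] in
lemma restrict_coe (hr : Function.Injective r) {Δ : Subgroup Γ}
    (hΔ : ∀ i j, r i ≠ r j → e (r i) (r j) ∈ Δ) {i j : κ} (hij : i ≠ j) :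
    (restrict e r Δ hΔ i j : Γ) = e (r i) (r j) := by
  rw [restrict, dif_neg (hr.ne hij)]

lemma isSteinbergSystem_restrict (hr : Function.Injective r) (h : IsSteinbergSystem e)
    {Δ : Subgroup Γ} (hΔ : ∀ i j, r i ≠ r j → e (r i) (r j) ∈ Δ) :
    IsSteinbergSystem (restrict e r Δ hΔ) := by
  have hc := h.comp hr
  refine ⟨fun h₁ h₂ h₃ h₄ => ?_, fun h₁ h₂ h₃ => ?_, fun h₁ => ?_⟩
  · have := (hc.comm h₁ h₂ h₃ h₄).eq
    exact Subtype.ext (by simpa [restrict_coe hr, h₁, h₂] using this)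
  · have := hc.mul h₁ h₂ h₃
    exact Subtype.ext (by simpa [restrict_coe hr, h₁, h₂, h₃, commutatorElement_def] using this)
  · have := hc.braid h₁
    exact Subtype.ext (by simpa [restrict_coe hr, h₁, h₁.symm] using this)

/-- Rigidity is applied to the stabilizer of `W` acting on `W`, since the whole group need not
preserve `W`; unipotence passes to the subspace. -/
lemma fixes_of_stable (hr : Function.Injective r) (hR : RigidBelow.{u, v, w, x} F κ d)
    (h : IsSteinbergSystem e) (hu : ∀ i j, i ≠ j → IsNilpotent (ρ (e i j) - 1))
    (hW : ∀ i j, r i ≠ r j → ∀ w ∈ W, ρ (e (r i) (r j)) w ∈ W)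
    (hd : Module.finrank F W < d) :
    ∀ i j, r i ≠ r j → ∀ w ∈ W, ρ (e (r i) (r j)) w = w := by
  intro i j hij w hw
  have hΔ : ∀ i j, r i ≠ r j → e (r i) (r j) ∈ ρ.setStabilizer W :=
    fun i j hij => Representation.mem_setStabilizer (hW i j hij)
  let σ : Representation F (ρ.setStabilizer W) W :=
    Representation.subrepresentation (ρ.comp (ρ.setStabilizer W).subtype) W fun g => g.2.1
  have hσ (g : ρ.setStabilizer W) (w : W) : ((σ g w : W) : V) = ρ g w := rfl
  have key := hR _ W _ σ (h.isSteinbergSystem_restrict hr hΔ) (fun i j hij => by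
    obtain ⟨k, hk⟩ := hu _ _ (hr.ne hij)
    refine ⟨k, LinearMap.ext fun w => Subtype.ext ?_⟩
    have (w : W) : (((σ (restrict e r _ hΔ i j) - 1) ^ k) w : V) =
        ((ρ (e (r i) (r j)) - 1) ^ k) w := by
      clear hk
      induction k generalizing w with
      | zero => rfl
      | succ k ih =>
        rw [pow_succ, pow_succ, Module.End.mul_apply, Module.End.mul_apply, ih]
        simp [hσ, restrict_coe hr hΔ hij]
    rw [this, hk]
    rfl) hd i j (ne_of_apply_ne r hij)
  have := congrArg (fun f : Module.End F W => ((f ⟨w, hw⟩ : W) : V)) key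
  simpa [hσ, restrict_coe hr hΔ (ne_of_apply_ne r hij)] using this

lemma fixes_quotient_of_stable (hr : Function.Injective r) (hR : RigidBelow.{u, v, w, x} F κ d)
    (h : IsSteinbergSystem e) (hu : ∀ i j, i ≠ j → IsNilpotent (ρ (e i j) - 1))
    (hW : ∀ i j, r i ≠ r j → ∀ w ∈ W, ρ (e (r i) (r j)) w ∈ W)
    (hd : Module.finrank F (V ⧸ W) < d) :
    ∀ i j, r i ≠ r j → ∀ v, ρ (e (r i) (r j)) v - v ∈ W := by
  intro i j hij v
  have hΔ : ∀ i j, r i ≠ r j → e (r i) (r j) ∈ ρ.setStabilizer W :=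
    fun i j hij => Representation.mem_setStabilizer (hW i j hij)
  let σ : Representation F (ρ.setStabilizer W) (V ⧸ W) :=
    Representation.quotient (ρ.comp (ρ.setStabilizer W).subtype) W fun g => g.2.1
  have hσ (g : ρ.setStabilizer W) (v : V) : σ g (W.mkQ v) = W.mkQ (ρ g v) := rfl
  have key := hR _ (V ⧸ W) _ σ (h.isSteinbergSystem_restrict hr hΔ) (fun i j hij => by
    obtain ⟨k, hk⟩ := hu _ _ (hr.ne hij)
    refine ⟨k, LinearMap.ext fun w => ?_⟩
    obtain ⟨v, rfl⟩ := W.mkQ_surjective w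
    have (v : V) : ((σ (restrict e r _ hΔ i j) - 1) ^ k) (W.mkQ v) =
        W.mkQ (((ρ (e (r i) (r j)) - 1) ^ k) v) := by
      clear hk
      induction k generalizing v with
      | zero => rfl
      | succ k ih =>
        rw [pow_succ, pow_succ, Module.End.mul_apply, Module.End.mul_apply, ← ih,
          LinearMap.sub_apply, hσ, restrict_coe hr hΔ hij, LinearMap.sub_apply,
          Module.End.one_apply, Module.End.one_apply, map_sub W.mkQ]
    rw [this, hk, LinearMap.zero_apply, map_zero, LinearMap.zero_apply])
    hd i j (ne_of_apply_ne r hij)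
  have := congrArg (fun f : Module.End F (V ⧸ W) => f (W.mkQ v)) key
  rw [hσ, restrict_coe hr hΔ (ne_of_apply_ne r hij)] at this
  exact (Submodule.Quotient.eq W).1 this

variable (e ρ i₀) in
/-- The common fixed space of the root elements in row `i₀`. -/
def rowFix : Submodule F V where
  carrier := {v | ∀ j, j ≠ i₀ → ρ (e i₀ j) v = v}
  add_mem' hv hw j hj := by rw [map_add, hv j hj, hw j hj]
  zero_mem' j _ := map_zero _
  smul_mem' c v hv j hj := by rw [map_smul, hv j hj]

omit [FiniteDimensional F V] in
-- An element `e i j` commutes with all of row `i₀` except `e i₀ i`, and moving it past that one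
-- costs only the factor `e i₀ j`, again in the row.
lemma rowFix_stable (h : IsSteinbergSystem e) :
    ∀ i j : {i // i ≠ i₀}, i.1 ≠ j.1 →
      ∀ w ∈ rowFix e ρ i₀, ρ (e i j) w ∈ rowFix e ρ i₀ := by
  rintro ⟨i, hi⟩ ⟨j, hj⟩ hij w hw k hk
  dsimp only at hij ⊢
  have hcomm (k) (hk : k ≠ i₀) (hki : k ≠ i) : ρ (e i₀ k) (ρ (e i j) w) = ρ (e i j) w := by
    rw [← Module.End.mul_apply, ← map_mul, (h.comm hk.symm hij hki hj.symm).eq, map_mul,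
      Module.End.mul_apply, hw k hk]
  by_cases hki : k = i
  · subst hki
    rw [← Module.End.mul_apply, ← map_mul, h.mul_mul hi.symm hij hj.symm, map_mul, map_mul,
      Module.End.mul_apply, Module.End.mul_apply, hw k hk, hcomm j hj hij.symm]
  · exact hcomm k hk hki

/-- The elements of one row commute with each other, so their unipotent actions have a common fixed
vector. -/
lemma rowFix_ne_bot [Nontrivial V] (h : IsSteinbergSystem e)
    (hu : ∀ i j, i ≠ j → IsNilpotent (ρ (e i j) - 1)) : rowFix e ρ i₀ ≠ ⊥ := by
  obtain ⟨v, hv, hN⟩ := exists_common_fixed (fun j : {j // j ≠ i₀} => ρ (e i₀ j) - 1)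
    (fun j => hu _ _ j.2.symm) (fun j k => by
      refine Commute.sub_left (Commute.sub_right ?_ (Commute.one_right _)) (Commute.one_left _)
      exact (h.comm j.2.symm k.2.symm j.2 k.2.symm).map ρ)
  exact (Submodule.ne_bot_iff _).2 ⟨v, fun j hj => sub_eq_zero.1 (hN ⟨j, hj⟩), hv⟩

lemma _root_.exists_ne_ne_of_two_lt_card [Finite ι] (hc : 2 < Nat.card ι) (i j : ι) :
    ∃ k, k ≠ i ∧ k ≠ j := by
  classical
  have := Fintype.ofFinite ι
  rw [Nat.card_eq_fintype_card] at hc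
  obtain ⟨k, -, hk⟩ := Finset.exists_mem_notMem_of_card_lt_card
    (s := {i, j}) (t := Finset.univ) (Finset.card_le_two.trans_lt (by simpa using hc))
  exact ⟨k, by simpa [not_or] using hk⟩

/-- Unipotent root elements act trivially in dimension less than the number of indices. -/
theorem rigidBelow (m : ℕ) : ∀ (ι : Type x) [Finite ι], Nat.card ι = m + 2 →
    RigidBelow.{u, v, w, x} F ι (m + 2) := by
  induction m with
  | zero =>
    intro ι _ _ Γ _ V _ _ _ e ρ h hu hd i j hij
    rcases subsingleton_or_nontrivial V with hV | hV
    · exact LinearMap.ext fun v => Subsingleton.elim _ _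
    -- A nonzero space of dimension below 2 is a line, and a unipotent operator on a line is the
    -- identity.
    obtain ⟨v, hv, hN⟩ := exists_common_fixed (fun _ : Unit => ρ (e i j) - 1)
      (fun _ => hu i j hij) (fun _ _ => Commute.refl _)
    have h1 : Module.finrank F V = 1 := by
      have := Module.finrank_pos (R := F) (M := V)
      omega
    refine LinearMap.ext fun w => ?_
    obtain ⟨c, rfl⟩ := (finrank_eq_one_iff_of_nonzero' v hv).1 h1 w
    rw [map_smul, sub_eq_zero.1 (hN ())]
    rfl
  | succ m ih =>
    intro ι _ hι Γ _ V _ _ _ e ρ h hu hd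
    have h3 : ∀ i j : ι, ∃ k, k ≠ i ∧ k ≠ j := exists_ne_ne_of_two_lt_card (by omega)
    rcases subsingleton_or_nontrivial V with hV | hV
    · exact fun i j hij => LinearMap.ext fun v => Subsingleton.elim _ _
    have : Nonempty ι := (Nat.card_pos_iff.1 (by omega)).1
    let i₀ : ι := Classical.arbitrary ι
    obtain ⟨j₀, hj₀, -⟩ := h3 i₀ i₀
    obtain ⟨k₀, hk₀, hkj⟩ := h3 i₀ j₀
    have hR := ih {i // i ≠ i₀} (by
      classical
      have := Fintype.ofFinite ι
      rw [Nat.card_eq_fintype_card] at hι ⊢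
      rw [Fintype.card_subtype_compl, Fintype.card_subtype_eq]
      omega)
    -- If the row acts trivially, so does the whole system. Otherwise the fixed space and its
    -- quotient both have dimension at most `m + 1`, and induction for the indices other than `i₀`
    -- applies to both.
    by_cases htop : rowFix e ρ i₀ = ⊤
    · have := (h.map (MonoidHom.toHomUnits ρ)).eq_one_of_eq_one h3 hj₀.symm
        ((map_eq_one_iff_toHomUnits ρ _).2 (LinearMap.ext fun v =>
          (htop ▸ Submodule.mem_top : v ∈ rowFix e ρ i₀) j₀ hj₀))
      exact fun k l hkl => (map_eq_one_iff_toHomUnits ρ _).1 (this k l hkl)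
    have h₁ := Submodule.finrank_lt htop
    have h₂ := Submodule.one_le_finrank_iff.2 (rowFix_ne_bot (i₀ := i₀) h hu)
    have h₃ := Submodule.finrank_quotient_add_finrank (rowFix e ρ i₀)
    have f₁ := fixes_of_stable Subtype.coe_injective hR h hu (rowFix_stable h) (by omega)
    have f₂ := fixes_quotient_of_stable Subtype.coe_injective hR h hu (rowFix_stable h) (by omega)
    exact h.rep_eq_one_of_flag h3 hkj (rowFix e ρ i₀) (f₁ ⟨_, hk₀⟩ ⟨_, hj₀⟩ hkj)
      (f₁ ⟨_, hj₀⟩ ⟨_, hk₀⟩ hkj.symm) (f₂ ⟨_, hk₀⟩ ⟨_, hj₀⟩ hkj) (f₂ ⟨_, hj₀⟩ ⟨_, hk₀⟩ hkj.symm)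

omit [FiniteDimensional F V] in
lemma mem_rowFix_dual {v : V} (hv : v ∈ rowFix (fun i j => (e j i)⁻¹) ρ i₀) {j : ι}
    (hj : j ≠ i₀) : ρ (e j i₀) v = v := by
  have := congrArg (ρ (e j i₀)) (hv j hj)
  rw [← Module.End.mul_apply, ← map_mul, mul_inv_cancel, map_one] at this
  exact this.symm

omit [FiniteDimensional F V] in
lemma isNilpotent_dual (hu : ∀ i j, i ≠ j → IsNilpotent (ρ (e i j) - 1)) (i j : ι)
    (hij : i ≠ j) : IsNilpotent (ρ (e j i)⁻¹ - 1) := by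
  have h₁ : ρ (e j i)⁻¹ - 1 = -(ρ (e j i)⁻¹ * (ρ (e j i) - 1)) := by
    rw [mul_sub, ← map_mul, inv_mul_cancel, map_one, mul_one, neg_sub]
  rw [h₁]
  refine (Commute.isNilpotent_mul_left ?_ (hu j i hij.symm)).neg
  refine Commute.sub_right ?_ (Commute.one_right _)
  exact ((Commute.refl (e j i)).inv_left).map ρ

/-- In dimension equal to the number of indices, the common fixed space of a row or that of a
column is a hyperplane. -/
theorem finrank_rowFix {m : ℕ} [Finite ι] (hι : Nat.card ι = m + 3)
    (hV : Module.finrank F V = m + 3) (h : IsSteinbergSystem e)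
    (hu : ∀ i j, i ≠ j → IsNilpotent (ρ (e i j) - 1))
    (h1 : ∃ i j, i ≠ j ∧ ρ (e i j) ≠ 1) (i₀ : ι) :
    Module.finrank F (rowFix e ρ i₀) = m + 2 ∨
      Module.finrank F (rowFix (fun i j => (e j i)⁻¹) ρ i₀) = m + 2 := by
  have h3 : ∀ i j : ι, ∃ k, k ≠ i ∧ k ≠ j := exists_ne_ne_of_two_lt_card (by omega)
  have : Nontrivial V := Module.nontrivial_of_finrank_pos (R := F) (by omega)
  obtain ⟨j₀, hj₀, -⟩ := h3 i₀ i₀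
  obtain ⟨k₀, hk₀, hkj⟩ := h3 i₀ j₀
  have hR : RigidBelow.{u, v, w, x} F {i // i ≠ i₀} (m + 2) := rigidBelow m _ (by
    classical
    have := Fintype.ofFinite ι
    rw [Nat.card_eq_fintype_card] at hι ⊢
    rw [Fintype.card_subtype_compl, Fintype.card_subtype_eq]
    omega)
  -- In any other dimension, the fixed space and its quotient are both small enough for the system
  -- without `i₀` to act trivially on them, which forces triviality.
  have dims (e : ι → ι → Γ) (h : IsSteinbergSystem e)
      (hu : ∀ i j, i ≠ j → IsNilpotent (ρ (e i j) - 1)) (h1 : ∃ i j, i ≠ j ∧ ρ (e i j) ≠ 1) :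
      Module.finrank F (rowFix e ρ i₀) = m + 2 ∨ Module.finrank F (rowFix e ρ i₀) = 1 := by
    obtain ⟨i, j, hij, h1⟩ := h1
    by_cases htop : rowFix e ρ i₀ = ⊤
    · have := (h.map (MonoidHom.toHomUnits ρ)).eq_one_of_eq_one h3 hj₀.symm
        ((map_eq_one_iff_toHomUnits ρ _).2 (LinearMap.ext fun v =>
          (htop ▸ Submodule.mem_top : v ∈ rowFix e ρ i₀) j₀ hj₀))
      exact (h1 ((map_eq_one_iff_toHomUnits ρ _).1 (this i j hij))).elim
    by_contra hd
    have h₁ := Submodule.finrank_lt htop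
    have h₂ := Submodule.one_le_finrank_iff.2 (rowFix_ne_bot (i₀ := i₀) h hu)
    have h₃ := Submodule.finrank_quotient_add_finrank (rowFix e ρ i₀)
    have f₁ := fixes_of_stable Subtype.coe_injective hR h hu (rowFix_stable h) (by omega)
    have f₂ := fixes_quotient_of_stable Subtype.coe_injective hR h hu (rowFix_stable h) (by omega)
    exact h1 (h.rep_eq_one_of_flag h3 hkj (rowFix e ρ i₀) (f₁ ⟨_, hk₀⟩ ⟨_, hj₀⟩ hkj)
      (f₁ ⟨_, hj₀⟩ ⟨_, hk₀⟩ hkj.symm) (f₂ ⟨_, hk₀⟩ ⟨_, hj₀⟩ hkj)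
      (f₂ ⟨_, hj₀⟩ ⟨_, hk₀⟩ hkj.symm) i j hij)
  have hud := isNilpotent_dual hu
  refine (dims e h hu h1).imp_right fun hA => (dims _ h.dual hud ?_).resolve_right fun hB => ?_
  · obtain ⟨i, j, hij, h1⟩ := h1
    refine ⟨j, i, hij.symm, fun h2 => h1 ?_⟩
    have := map_mul ρ (e i j) (e i j)⁻¹
    rw [mul_inv_cancel, map_one, h2, mul_one] at this
    exact this.symm
  obtain ⟨i, j, hij, h1⟩ := h1
  -- It remains to exclude that both fixed spaces are lines. The system without `i₀` fixes each of
  -- them pointwise.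
  have fA := fixes_of_stable Subtype.coe_injective hR h hu (rowFix_stable h) (by omega)
  have fB' := fixes_of_stable Subtype.coe_injective hR h.dual hud (rowFix_stable h.dual) (by omega)
  set A := rowFix e ρ i₀ with hAdef
  set B := rowFix (fun i j => (e j i)⁻¹) ρ i₀ with hBdef
  have fB : ∀ i j : {i // i ≠ i₀}, i.1 ≠ j.1 → ∀ w ∈ B, ρ (e i j) w = w := by
    intro i j hij w hw
    have := congrArg (ρ (e i j)) (fB' j i hij.symm w hw)
    rw [← Module.End.mul_apply, ← map_mul, mul_inv_cancel, map_one] at this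
    exact this.symm
  -- A common line is fixed by every root element, and the full system acts trivially on its
  -- quotient of dimension `m + 2`.
  by_cases hAB : A = B
  · have fA' : ∀ i j : ι, i ≠ j → ∀ w ∈ A, ρ (e i j) w = w := by
      intro i j hij w hw
      by_cases hi : i = i₀
      · subst hi
        exact hw j hij.symm
      by_cases hj : j = i₀
      · subst hj
        exact mem_rowFix_dual (hAB.le hw) hi
      exact fA ⟨i, hi⟩ ⟨j, hj⟩ hij w hw
    have h₃ := Submodule.finrank_quotient_add_finrank A
    have f₂ := fixes_quotient_of_stable (r := id) (W := A) Function.injective_id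
      (rigidBelow (m + 1) ι hι) h hu
      (fun i j hij w hw => by rw [id, id, fA' i j hij w hw]; exact hw) (by omega)
    exact h1 (h.rep_eq_one_of_flag h3 hkj A (fA' _ _ hkj) (fA' _ _ hkj.symm) (f₂ _ _ hkj)
      (f₂ _ _ hkj.symm) i j hij)
  -- Distinct lines leave a quotient by `A ⊔ B` of dimension at most `m + 1`, where the system
  -- without `i₀` acts trivially.
  · have hP : A < A ⊔ B := by
      refine lt_of_le_of_ne le_sup_left fun hP => hAB ?_
      exact (Submodule.eq_of_le_of_finrank_eq (left_eq_sup.1 hP) (hB.trans hA.symm)).symm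
    have hP' := Submodule.finrank_lt_finrank_of_lt hP
    have h₃ := Submodule.finrank_quotient_add_finrank (A ⊔ B)
    have f₁ : ∀ i j : {i // i ≠ i₀}, i.1 ≠ j.1 → ∀ w ∈ A ⊔ B, ρ (e i j) w = w := by
      intro i j hij w hw
      obtain ⟨a, ha, b, hb, rfl⟩ := Submodule.mem_sup.1 hw
      rw [map_add, fA i j hij a ha, fB i j hij b hb]
    have f₂ := fixes_quotient_of_stable (W := A ⊔ B) Subtype.coe_injective hR h hu
      (fun i j hij w hw => by rw [f₁ i j hij w hw]; exact hw) (by omega)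
    exact h1 (h.rep_eq_one_of_flag h3 hkj (A ⊔ B) (f₁ ⟨_, hk₀⟩ ⟨_, hj₀⟩ hkj)
      (f₁ ⟨_, hj₀⟩ ⟨_, hk₀⟩ hkj.symm) (f₂ ⟨_, hk₀⟩ ⟨_, hj₀⟩ hkj)
      (f₂ ⟨_, hj₀⟩ ⟨_, hk₀⟩ hkj.symm) i j hij)

end Representation

end IsSteinbergSystem

/-! ### Construction of a basis from a fixed hyperplane -/

namespace IsSteinbergSystem

/-- This is how unipotence is used below: each time an undetermined scalar is recognized as an
eigenvalue. -/
lemma _root_.Module.End.eq_zero_of_isNilpotent {F V : Type*} [Field F] [AddCommGroup V]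
    [Module F V] {N : Module.End F V} (hN : IsNilpotent N) {c : F} {x : V} (hx : x ≠ 0)
    (h : N x = c • x) : c = 0 := by
  obtain ⟨k, hk⟩ := hN
  have : (N ^ k) x = c ^ k • x := by
    clear hk
    induction k with
    | zero => simp
    | succ k ih => rw [pow_succ', Module.End.mul_apply, ih, map_smul, h, smul_smul, ← pow_succ]
  rw [hk, LinearMap.zero_apply] at this
  exact eq_zero_of_pow_eq_zero ((smul_eq_zero.1 this.symm).resolve_right hx)

variable {ι : Type x} {Γ : Type v} {F : Type u} {V : Type w} [Group Γ] [Field F]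
  [AddCommGroup V] [Module F V] {e : ι → ι → Γ} {ρ : Representation F Γ V}
  [FiniteDimensional F V]

/-- If the common fixed space of a column is a hyperplane, the root elements act as elementary
transvections with respect to a basis. -/
theorem exists_basis {m : ℕ} [Fintype ι] [DecidableEq ι] (hι : Nat.card ι = m + 3)
    (hV : Module.finrank F V = m + 3) (h : IsSteinbergSystem e)
    (hu : ∀ i j, i ≠ j → IsNilpotent (ρ (e i j) - 1))
    (h1 : ∃ i j, i ≠ j ∧ ρ (e i j) ≠ 1) (o : ι) (hconj : ∀ j, j ≠ o → IsConj (e j o) (e o j))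
    (hfix : Module.finrank F (rowFix (fun i j => (e j i)⁻¹) ρ o) = m + 2) :
    ∃ b : Module.Basis ι F V, ∀ i j k, i ≠ j →
      ρ (e i j) (b k) = b k + if j = k then b i else 0 := by
  have h3 : ∀ i j : ι, ∃ k, k ≠ i ∧ k ≠ j := exists_ne_ne_of_two_lt_card (by omega)
  have hne : ∀ i j, i ≠ j → ρ (e i j) ≠ 1 := by
    intro i j hij h2
    obtain ⟨k, l, hkl, h1⟩ := h1
    have := (h.map (MonoidHom.toHomUnits ρ)).eq_one_of_eq_one h3 hij
      ((map_eq_one_iff_toHomUnits ρ _).2 h2)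
    exact h1 ((map_eq_one_iff_toHomUnits ρ _).1 (this k l hkl))
  -- The fixed hyperplane is the kernel of a functional `f`, so each `e i o` acts by `x ↦ x + f x •
  -- u i` with the same `f` for the whole column.
  obtain ⟨f, hf0, hf⟩ := Submodule.exists_le_ker_of_lt_top
    (rowFix (fun i j => (e j i)⁻¹) ρ o) (lt_top_iff_ne_top.2 fun ht => by
      rw [ht, finrank_top] at hfix
      omega)
  have hker : rowFix (fun i j => (e j i)⁻¹) ρ o = LinearMap.ker f := by
    refine Submodule.eq_of_le_of_finrank_le hf ?_
    have := Module.Dual.finrank_ker_add_one_of_ne_zero hf0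
    omega
  obtain ⟨v₀, hv₀⟩ : ∃ v, f v = 1 := LinearMap.surjective hf0 1
  -- the action of column `o`
  let u (i : ι) : V := ρ (e i o) v₀ - v₀
  have hcol (i : ι) (hi : i ≠ o) (x : V) : ρ (e i o) x = x + f x • u i := by
    have hx : x - f x • v₀ ∈ rowFix (fun i j => (e j i)⁻¹) ρ o := by
      rw [hker, LinearMap.mem_ker, map_sub, map_smul, hv₀, smul_eq_mul, mul_one, sub_self]
    have := mem_rowFix_dual hx hi
    rw [map_sub, map_smul, sub_eq_iff_eq_add] at this
    rw [this, smul_sub]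
    abel
  have hu0 (i : ι) (hi : i ≠ o) : u i ≠ 0 := fun h0 => hne i o hi
    (LinearMap.ext fun x => by rw [hcol i hi, h0, smul_zero, add_zero]; rfl)
  have hfu (i : ι) (hi : i ≠ o) : f (u i) = 0 :=
    Module.End.eq_zero_of_isNilpotent (hu i o hi) (hu0 i hi) (by
      rw [LinearMap.sub_apply, hcol i hi, Module.End.one_apply, add_sub_cancel_left])
  -- the action of the other root elements on the hyperplane
  have comm {i j k l : ι} (h₁ : i ≠ j) (h₂ : k ≠ l) (h₃ : j ≠ k) (h₄ : i ≠ l) (x : V) :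
      ρ (e i j) (ρ (e k l) x) = ρ (e k l) (ρ (e i j) x) := by
    rw [← Module.End.mul_apply, ← map_mul, (h.comm h₁ h₂ h₃ h₄).eq, map_mul, Module.End.mul_apply]
  have mul {i j k : ι} (h₁ : i ≠ j) (h₂ : j ≠ k) (h₃ : i ≠ k) (x : V) :
      ρ (e i j) (ρ (e j k) x) = ρ (e i k) (ρ (e j k) (ρ (e i j) x)) := by
    simp only [← Module.End.mul_apply, ← map_mul]
    rw [h.mul_mul h₁ h₂ h₃, mul_assoc]
  -- Evaluate the commutation of `e i j` with `e k o` at `v₀`. For `k = i` this makes `u i` an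
  -- eigenvector, so the scalar is 1 by unipotence.
  have hscal (i j k : ι) (hi : i ≠ o) (hij : i ≠ j) (hk : k ≠ o) (hkj : j ≠ k) :
      ρ (e i j) (u k) + ρ (e i j) v₀ = ρ (e i j) v₀ + f (ρ (e i j) v₀) • u k := by
    rw [← hcol k hk, ← comm hij hk hkj hi, ← map_add, hcol k hk, hv₀, one_smul, add_comm]
  have hone (i j : ι) (hi : i ≠ o) (hij : i ≠ j) : f (ρ (e i j) v₀) = 1 := by
    refine sub_eq_zero.1 (Module.End.eq_zero_of_isNilpotent (hu i j hij) (hu0 i hi) ?_)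
    have := hscal i j i hi hij hi hij.symm
    rw [add_comm, add_left_cancel_iff] at this
    rw [LinearMap.sub_apply, this, sub_smul, one_smul, Module.End.one_apply]
  have hfixu (i j k : ι) (hi : i ≠ o) (hij : i ≠ j) (hk : k ≠ o) (hkj : j ≠ k) :
      ρ (e i j) (u k) = u k := by
    have := hscal i j k hi hij hk hkj
    rwa [add_comm, add_left_cancel_iff, hone i j hi hij, one_smul] at this
  -- The relation for `e i j`, `e j o` and `e i o`, evaluated at `v₀`.
  have hmoveu (i j : ι) (hi : i ≠ o) (hj : j ≠ o) (hij : i ≠ j) :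
      ρ (e i j) (u j) = u j + u i := by
    have := mul hij hj hi v₀
    rw [hcol j hj, hcol j hj, hcol i hi, map_add, map_add, map_smul, map_smul, hfu j hj,
      hone i j hi hij, hv₀, one_smul, one_smul, smul_zero, add_zero, one_smul,
      add_assoc, add_left_cancel_iff] at this
    exact this
  -- the action of row `o`
  have hrow (j : ι) (hj : j ≠ o) : ∃ (g : Module.Dual F V) (y : V), y ≠ 0 ∧
      ∀ x, ρ (e o j) x = x + g x • y := by
    obtain ⟨c, hc⟩ := isConj_iff.1 (hconj j hj)
    have hinj := (ρ.apply_bijective c).1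
    refine ⟨f ∘ₗ ρ c⁻¹, ρ c (u j), (map_ne_zero_iff _ hinj).2 (hu0 j hj), fun x => ?_⟩
    rw [← hc, map_mul, map_mul, Module.End.mul_apply, Module.End.mul_apply, hcol j hj, map_add,
      map_smul, LinearMap.comp_apply, ← Module.End.mul_apply, ← map_mul, mul_inv_cancel, map_one]
    rfl
  -- Candidate for the basis vector at `o`; it must be shown not to depend on `j`.
  let y (j : ι) : V := ρ (e o j) (u j) - u j
  have hrowu (j k : ι) (hj : j ≠ o) (hk : k ≠ o) (hjk : j ≠ k) : ρ (e o j) (u k) = u k := by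
    obtain ⟨l, hlo, hlk⟩ := h3 o k
    obtain ⟨g, y, hy, hg⟩ := hrow j hj
    have h₁ := hmoveu k l hk hlo hlk.symm
    have h₂ := comm hj.symm hlk.symm hjk hlo.symm (u l)
    rw [h₁, map_add, hg, hg, map_add, map_smul, h₁] at h₂
    suffices g (u k) = 0 by rw [hg, this, zero_smul, add_zero]
    -- Commutation of `e o j` with `e k l` at `u l`. If `g (u l)` is nonzero, `y` is an eigenvector
    -- of a nilpotent operator, and again `g (u k) = 0`.
    have h₄ : g (u k) • y = g (u l) • (ρ (e k l) - 1) y := by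
      rw [LinearMap.sub_apply, smul_sub, Module.End.one_apply, eq_sub_iff_add_eq]
      have h₅ : u l + u k + (g (u k) • y + g (u l) • y) = u l + u k + g (u l) • ρ (e k l) y := by
        rw [← h₂]
        abel
      exact add_left_cancel h₅
    by_cases hgl : g (u l) = 0
    · rw [hgl, zero_smul] at h₄
      exact (smul_eq_zero.1 h₄).resolve_right hy
    · have := Module.End.eq_zero_of_isNilpotent (hu k l hlk.symm) hy
        (c := (g (u l))⁻¹ * g (u k)) (by
          rw [mul_smul, h₄, smul_smul, inv_mul_cancel₀ hgl, one_smul])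
      exact (mul_eq_zero.1 this).resolve_left (inv_ne_zero hgl)
  have hy (i j : ι) (hi : i ≠ o) (hj : j ≠ o) (hij : i ≠ j) :
      f (y j) = 1 ∧ ρ (e i j) (y j) = y j ∧
      ∃ g : Module.Dual F V, ∀ x, ρ (e o j) x = x + g x • y j := by
    obtain ⟨g, z, hz, hg⟩ := hrow j hj
    have hyz : y j = g (u j) • z := by simp only [y]; rw [hg, add_sub_cancel_left]
    -- The relation for `e i o`, `e o j` and `e i j` at `u j`, together with commutation of `e o j`
    -- and `e i j`, normalizes the product of the two scalars to 1.
    have h₁ := mul hi hj.symm hij (u j)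
    rw [hcol i hi (u j), hfu j hj, zero_smul, add_zero, hg, map_add, map_smul, hcol i hi, hcol i hi,
      hfu j hj, zero_smul, add_zero, map_add, map_smul, hmoveu i j hi hj hij] at h₁
    have h₂ := comm hj.symm hij hij.symm hj.symm (u j)
    rw [hmoveu i j hi hj hij, map_add, hrowu j i hj hi hij.symm, hg, map_add, map_smul,
      hmoveu i j hi hj hij] at h₂
    have h₃ : g (u j) • z = g (u j) • ρ (e i j) z := by
      refine add_left_cancel (a := u j + u i) ?_
      rw [← h₂]
      abel
    rw [← h₃, smul_add, add_assoc, add_left_cancel_iff, add_comm, add_right_cancel_iff,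
      smul_smul] at h₁
    have h₄ : g (u j) * f z = 1 := by
      refine sub_eq_zero.1 ((smul_eq_zero.1 ?_).resolve_right (hu0 i hi))
      rw [sub_smul, h₁, one_smul, sub_self]
    refine ⟨by rw [hyz, map_smul, smul_eq_mul, h₄], by rw [hyz, map_smul, ← h₃],
      (g (u j))⁻¹ • g, fun x => ?_⟩
    rw [hg, hyz, LinearMap.smul_apply, smul_smul, smul_eq_mul, mul_right_comm,
      inv_mul_cancel₀ (left_ne_zero_of_mul_eq_one h₄), one_mul]
  have hyeq (i j : ι) (hi : i ≠ o) (hj : j ≠ o) : y i = y j := by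
    by_cases hij : i = j
    · rw [hij]
    -- The relation for `e o j`, `e j i` and `e o i` at `u i` compares the two vectors.
    have h₁ := mul hj.symm (Ne.symm hij) hi.symm (u i)
    have h₂ (j : ι) : ρ (e o j) (u j) = u j + y j := (add_sub_cancel _ _).symm
    rw [hmoveu j i hj hi (Ne.symm hij), map_add, hrowu j i hj hi (Ne.symm hij), h₂,
      hmoveu j i hj hi (Ne.symm hij), map_add, h₂, hrowu i j hi hj hij] at h₁
    refine (add_left_cancel (a := u i + u j) ?_).symm
    rw [add_assoc, h₁]
    abel
  obtain ⟨p, hp, -⟩ := h3 o o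
  obtain ⟨q, hq, hqp⟩ := h3 o p
  let b (i : ι) : V := if i = o then y p else u i
  have hbo : b o = y p := if_pos rfl
  have hbu (i : ι) (hi : i ≠ o) : b i = u i := if_neg hi
  have hb (i j k : ι) (hij : i ≠ j) : ρ (e i j) (b k) = b k + if j = k then b i else 0 := by
    by_cases hj : j = o
    · subst hj
      rw [hcol i hij, hbu i hij]
      by_cases hk : k = j
      · subst hk
        rw [if_pos rfl, hbo, (hy q p hq hp hqp).1, one_smul]
      · rw [if_neg (Ne.symm hk), hbu k hk, hfu k hk, zero_smul]
    by_cases hi : i = o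
    · subst hi
      by_cases hk : k = i
      · subst hk
        obtain ⟨l, hlo, hlj⟩ := h3 k j
        obtain ⟨h₁, -, g, hg⟩ := hy l j hlo hj hlj
        have : g (y j) = 0 := Module.End.eq_zero_of_isNilpotent (hu k j hij)
          (x := y j) (fun h0 => by rw [h0, map_zero] at h₁; exact zero_ne_one h₁)
          (by rw [LinearMap.sub_apply, hg, Module.End.one_apply, add_sub_cancel_left])
        rw [if_neg hj, hbo, hyeq p j hp hj, hg, this, zero_smul]
      · rw [hbu k hk]
        by_cases hjk : j = k
        · subst hjk
          rw [if_pos rfl, hbo, hyeq p j hp hj]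
          exact (add_sub_cancel _ _).symm
        · rw [if_neg hjk, add_zero, hrowu j k hj hk hjk]
    by_cases hk : k = o
    · subst hk
      rw [if_neg hj, add_zero, hbo, hyeq p j hp hj, (hy i j hi hj hij).2.1]
    rw [hbu k hk, hbu i hi]
    by_cases hjk : j = k
    · subst hjk
      rw [if_pos rfl, hmoveu i j hi hj hij]
    · rw [if_neg hjk, add_zero, hfixu i j k hi hij hk hjk]
  have hb0 (i : ι) : b i ≠ 0 := by
    by_cases hi : i = o
    · rw [hi, hbo]
      intro h0
      have := (hy q p hq hp hqp).1
      rw [h0, map_zero] at this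
      exact zero_ne_one this
    · rw [hbu i hi]
      exact hu0 i hi
  -- The operator `ρ (e i j) - 1` sends `b j` to `b i` and kills the other vectors, so it isolates
  -- the coefficient of `b j` in a linear relation.
  have hli : LinearIndependent F b := by
    rw [Fintype.linearIndependent_iff]
    intro c hc j
    obtain ⟨i, hij, -⟩ := h3 j j
    have := congrArg (ρ (e i j)) hc
    rw [map_sum, map_zero] at this
    simp_rw [map_smul, hb i j _ hij, smul_add, Finset.sum_add_distrib, hc, smul_ite,
      smul_zero, zero_add, Finset.sum_ite_eq, Finset.mem_univ, if_true] at this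
    exact (smul_eq_zero.1 this).resolve_right (hb0 i)
  have : Nonempty ι := ⟨o⟩
  refine ⟨basisOfLinearIndependentOfCardEqFinrank hli (by
    rw [← Nat.card_eq_fintype_card, hι, hV]), fun i j k hij => ?_⟩
  simpa using hb i j k hij

end IsSteinbergSystem

/-! ### Unipotence in the language of groups -/

/-- A condition, in terms of the group operations only, that forces matrices over a field of
characteristic `c` to be unipotent. -/
def UnipotentCondition {G : Type*} [Group G] (c n : ℕ) (x : G) : Prop :=
  if c = 0 then IsConj x (x ^ 2) ∧ IsConj x (x ^ (2 ^ n.factorial - 1)) else x ^ c = 1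

namespace Matrix

variable {n : ℕ}

/-- The characteristic polynomial is a power of `X - 1`; apply Cayley–Hamilton. -/
lemma isNilpotent_sub_one_of_spectrum {K : Type*} [Field K] [IsAlgClosed K]
    (A : Matrix (Fin n) (Fin n) K) (h : ∀ c ∈ spectrum K A, c = 1) : IsNilpotent (A - 1) := by
  have hroots : A.charpoly.roots = Multiset.replicate A.charpoly.roots.card 1 :=
    Multiset.eq_replicate_card.2 fun c hc =>
      h c (mem_spectrum_of_isRoot_charpoly (Polynomial.isRoot_of_mem_roots hc))
  have hp := (IsAlgClosed.splits A.charpoly).eq_prod_roots_of_monic A.charpoly_monic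
  rw [hroots, Multiset.map_replicate, Multiset.prod_replicate] at hp
  refine ⟨A.charpoly.roots.card, ?_⟩
  have := aeval_self_charpoly A
  rw [hp] at this
  simpa using this

/-- Conjugacy to the square makes squaring a permutation of at most `n` eigenvalues. Its `n!`-th
iterate is the identity, so every eigenvalue has trivial power with exponent `2 ^ n! - 1`. By the
second conjugacy every eigenvalue is such a power. -/
lemma spectrum_eq_one_of_isConj {K : Type*} [Field K] [IsAlgClosed K]
    (A : (Matrix (Fin n) (Fin n) K)ˣ)
    (h₂ : IsConj A (A ^ 2)) (h : IsConj A (A ^ (2 ^ n.factorial - 1))) :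
    ∀ c ∈ spectrum K (A : Matrix (Fin n) (Fin n) K), c = 1 := by
  have key (k : ℕ) (hk : 0 < k) (h : IsConj A (A ^ k)) :
      (fun c => c ^ k) '' spectrum K (A : Matrix (Fin n) (Fin n) K) = spectrum K A.1 := by
    rw [← spectrum.map_pow_of_pos A.1 hk]
    obtain ⟨c, hc⟩ := isConj_iff.1 h
    have := spectrum.units_conjugate (R := K) (a := A.1) (u := c)
    rw [← this, ← Units.val_pow_eq_pow_val, ← hc]
    rfl
  classical
  have hsub : spectrum K A.1 ⊆ A.1.charpoly.roots.toFinset := fun c hc => by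
    rw [Finset.mem_coe, Multiset.mem_toFinset, Polynomial.mem_roots A.1.charpoly_monic.ne_zero]
    exact mem_spectrum_iff_isRoot_charpoly.1 hc
  have := (A.1.charpoly.roots.toFinset.finite_toSet.subset hsub).fintype
  have hcard : Fintype.card (spectrum K A.1) ≤ n := by
    rw [← Set.toFinset_card]
    refine (Finset.card_le_card (by simpa [← Finset.coe_subset] using hsub)).trans
      ((Multiset.toFinset_card_le _).trans ((Polynomial.card_roots' _).trans ?_))
    rw [charpoly_natDegree_eq_dim, Fintype.card_fin]
  let f : spectrum K A.1 → spectrum K A.1 := fun c => ⟨c ^ 2, by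
    have := key 2 two_pos h₂
    exact this.le ⟨c, c.2, rfl⟩⟩
  have hf : Function.Surjective f := fun ⟨c, hc⟩ => by
    rw [← key 2 two_pos h₂] at hc
    obtain ⟨d, hd, rfl⟩ := hc
    exact ⟨⟨d, hd⟩, rfl⟩
  let σ : Equiv.Perm (spectrum K A.1) := Equiv.ofBijective f
    (Finite.injective_iff_surjective.2 hf |>.bijective_of_finite)
  have hσ : σ ^ n.factorial = 1 := by
    obtain ⟨k, hk⟩ := Nat.factorial_dvd_factorial hcard
    rw [hk, pow_mul, ← Fintype.card_perm, pow_card_eq_one, one_pow]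
  have hpow (k : ℕ) (c : spectrum K A.1) : ((σ ^ k) c : K) = c ^ 2 ^ k := by
    induction k with
    | zero => simp
    | succ k ih =>
      rw [pow_succ', Equiv.Perm.mul_apply, pow_succ 2, pow_mul, ← ih]
      rfl
  intro c hc
  rw [← key _ (Nat.sub_pos_of_lt (Nat.one_lt_two_pow n.factorial_ne_zero)) h] at hc
  obtain ⟨d, hd, rfl⟩ := hc
  have h₁ := hpow n.factorial ⟨d, hd⟩
  rw [hσ, Equiv.Perm.one_apply] at h₁
  have hd0 : d ≠ 0 := by
    rintro rfl
    exact spectrum.zero_notMem K A.isUnit hd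
  refine mul_left_cancel₀ hd0 ?_
  dsimp only at h₁ ⊢
  rw [← pow_succ', Nat.sub_add_cancel Nat.one_le_two_pow, ← h₁, mul_one]

lemma isNilpotent_of_unipotentCondition {F : Type*} [Field F] (hn : 0 < n)
    (A : GeneralLinearGroup (Fin n) F) (h : UnipotentCondition (ringChar F) n A) :
    IsNilpotent ((A : Matrix (Fin n) (Fin n) F) - 1) := by
  have : Nonempty (Fin n) := ⟨⟨0, hn⟩⟩
  unfold UnipotentCondition at h
  split_ifs at h with hc
  · let f : Matrix (Fin n) (Fin n) F →+* Matrix (Fin n) (Fin n) (AlgebraicClosure F) :=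
      (algebraMap F (AlgebraicClosure F)).mapMatrix
    have hf : Function.Injective f :=
      Matrix.map_injective (algebraMap F (AlgebraicClosure F)).injective
    refine (IsNilpotent.map_iff hf).1 ?_
    rw [map_sub, map_one]
    let g := Units.map f.toMonoidHom
    have h₁ := g.map_isConj h.1
    have h₂ := g.map_isConj h.2
    rw [map_pow] at h₁ h₂
    exact isNilpotent_sub_one_of_spectrum _ (spectrum_eq_one_of_isConj (g A) h₁ h₂)
  · have := Fact.mk ((CharP.char_is_prime_or_zero F (ringChar F)).resolve_right hc)
    have : ExpChar F (ringChar F) := inferInstance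
    -- In characteristic `p`, Frobenius gives `(A - 1) ^ p = A ^ p - 1 = 0`.
    refine ⟨ringChar F, ?_⟩
    rw [sub_pow_char_of_commute _ (Commute.one_right _), one_pow, ← Units.val_pow_eq_pow_val, h,
      Units.val_one, sub_self]

/-! ### Elementary transvections -/

variable {F : Type*} [Field F]

/-- The elementary transvection with entry `a` in position `(i, j)`; the identity if `i = j`. -/
def rootElement (i j : Fin n) (a : F) : GeneralLinearGroup (Fin n) F :=
  if h : i ≠ j then (SpecialLinearGroup.transvection h a).toGL else 1

lemma rootElement_self (i : Fin n) (a : F) : rootElement i i a = 1 := dif_neg (by simp)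

lemma coe_rootElement {i j : Fin n} (h : i ≠ j) (a : F) :
    (rootElement i j a : Matrix (Fin n) (Fin n) F) = 1 + single i j a := by
  rw [rootElement, dif_pos h]
  rfl

lemma rootElement_zero (i j : Fin n) : rootElement i j (0 : F) = 1 := by
  by_cases h : i = j
  · rw [h, rootElement_self]
  · ext1
    rw [coe_rootElement h, single_zero, add_zero, Units.val_one]

lemma rootElement_add (i j : Fin n) (a b : F) :
    rootElement i j (a + b) = rootElement i j a * rootElement i j b := by
  by_cases h : i = j
  · simp [h, rootElement_self]
  · ext1
    rw [Units.val_mul, coe_rootElement h, coe_rootElement h, coe_rootElement h, mul_add, add_mul,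
      add_mul, single_mul_single_of_ne _ _ _ _ (Ne.symm h), single_add]
    simp [add_assoc]

lemma rootElement_neg (i j : Fin n) (a : F) : rootElement i j (-a) = (rootElement i j a)⁻¹ := by
  rw [eq_inv_iff_mul_eq_one, ← rootElement_add, neg_add_cancel, rootElement_zero]

lemma rootElement_pow (i j : Fin n) (a : F) (k : ℕ) :
    rootElement i j a ^ k = rootElement i j (k * a) := by
  induction k with
  | zero => simp [rootElement_zero]
  | succ k ih => rw [pow_succ, ih, ← rootElement_add, Nat.cast_succ, add_mul, one_mul]

lemma rootElement_injective {i j : Fin n} (h : i ≠ j) :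
    Function.Injective (rootElement i j : F → _) := by
  intro a b hab
  have := congrArg (fun g : GeneralLinearGroup (Fin n) F => (g : Matrix _ _ F) i j) hab
  simpa [coe_rootElement h, h] using this

lemma commutator_rootElement {i j k : Fin n} (hij : i ≠ j) (hjk : j ≠ k) (hik : i ≠ k) (a b : F) :
    ⁅rootElement i j a, rootElement j k b⁆ = rootElement i k (a * b) := by
  rw [commutatorElement_def, mul_inv_eq_iff_eq_mul, mul_inv_eq_iff_eq_mul]
  ext1
  simp only [Units.val_mul, coe_rootElement hij, coe_rootElement hjk, coe_rootElement hik, mul_add,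
    add_mul, mul_one, one_mul, single_mul_single_same,
    single_mul_single_of_ne _ _ _ _ (Ne.symm hik),
    single_mul_single_of_ne _ _ _ _ (Ne.symm hjk), add_zero]
  abel

lemma commute_rootElement {i j k l : Fin n} (hjk : j ≠ k) (hil : i ≠ l) (a b : F) :
    Commute (rootElement i j a) (rootElement k l b) := by
  by_cases hij : i = j
  · rw [hij, rootElement_self]
    exact Commute.one_left _
  by_cases hkl : k = l
  · rw [hkl, rootElement_self]
    exact Commute.one_right _
  rw [Commute, SemiconjBy]
  ext1
  simp only [Units.val_mul, coe_rootElement hij, coe_rootElement hkl, mul_add,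
    add_mul, mul_one, one_mul, single_mul_single_of_ne _ _ _ _ hjk,
    single_mul_single_of_ne _ _ _ _ (Ne.symm hil), add_zero]
  abel

/-- A permutation matrix moves the position and a diagonal matrix rescales the entry. -/
lemma isConj_rootElement {i j k l : Fin n} (hij : i ≠ j) (hkl : k ≠ l) {a : F} (ha : a ≠ 0) :
    IsConj (rootElement i j (1 : F)) (rootElement k l a) := by
  obtain ⟨σ, hk, hl⟩ : ∃ σ : Equiv.Perm (Fin n), σ k = i ∧ σ l = j := by
    have h₁ : i ≠ Equiv.swap k i l := fun h => hkl ((Equiv.swap k i).injective (by simpa using h))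
    -- The first swap takes `k` to `i`; the second corrects the image of `l` without moving `i`.
    exact ⟨Equiv.swap (Equiv.swap k i l) j * Equiv.swap k i,
      by simp [Equiv.swap_apply_of_ne_of_ne h₁ hij], by simp⟩
  let t : Fin n → F := fun m => if m = i then a else 1
  let C : Matrix (Fin n) (Fin n) F := σ.permMatrix F * diagonal t
  have hC : IsUnit C := by
    rw [isUnit_iff_isUnit_det, det_mul, det_permutation, det_diagonal]
    refine IsUnit.mul (by simpa using (Int.isUnit_iff.2 (Int.units_eq_one_or _ |>.imp
      (congrArg Units.val) (congrArg Units.val))).map (Int.castRingHom F)) ?_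
    exact isUnit_iff_ne_zero.2 (Finset.prod_ne_zero_iff.2 fun m _ => by
      simp only [t]; split_ifs <;> simp [ha])
  refine isConj_iff.2 ⟨hC.unit, ?_⟩
  rw [mul_inv_eq_iff_eq_mul]
  ext1
  rw [Units.val_mul, Units.val_mul, coe_rootElement hij, coe_rootElement hkl, IsUnit.unit_spec,
    mul_add, add_mul, mul_one, one_mul, add_right_inj]
  have h₁ : diagonal t * single i j 1 = single i j a := by
    ext r m
    by_cases hr : i = r <;> simp [diagonal_mul, single_apply, hr, t]
  have h₂ : single k j a * diagonal t = single k j a := by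
    ext r m
    by_cases hm : j = m <;> simp [mul_diagonal, single_apply, hm, t]
    grind
  have h₃ : σ.permMatrix F * single i j a = single k j a := by
    ext r m
    rw [PEquiv.toMatrix_toPEquiv_mul, submatrix_apply, single_apply, single_apply, ← hk]
    simp only [σ.injective.eq_iff, id]
  have h₄ : single k l a * σ.permMatrix F = single k j a := by
    ext r m
    rw [PEquiv.mul_toMatrix_toPEquiv, submatrix_apply, single_apply, single_apply, ← hl]
    simp only [Equiv.eq_symm_apply, id]
  rw [mul_assoc, h₁, h₃, ← mul_assoc, h₄, h₂]

lemma isSteinbergSystem_rootElement :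
    IsSteinbergSystem fun i j : Fin n => rootElement i j (1 : F) where
  comm _ _ h₃ h₄ := commute_rootElement h₃ h₄ 1 1
  mul h₁ h₂ h₃ := by rw [commutator_rootElement h₁ h₂ h₃, mul_one]
  braid {i j} h := by
    rw [← rootElement_neg]
    ext1
    simp only [Units.val_mul, coe_rootElement h, coe_rootElement h.symm, mul_add,
      add_mul, mul_one, one_mul, single_mul_single_same, single_mul_single_of_ne _ _ _ _ h,
      single_mul_single_of_ne _ _ _ _ h.symm, add_zero, mul_neg, neg_mul, ← single_neg]
    abel

/-- Powers multiply the entry by integers: nonzero ones in characteristic 0, where all nontrivial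
root elements are conjugate, and zero for the exponent `p`. -/
lemma unipotentCondition_rootElement {i j : Fin n} (h : i ≠ j) :
    UnipotentCondition (ringChar F) n (rootElement i j (1 : F)) := by
  unfold UnipotentCondition
  split_ifs with hc
  · have : CharZero F := (CharP.ringChar_zero_iff_CharZero F).1 hc
    have hM := Nat.sub_pos_of_lt (Nat.one_lt_two_pow n.factorial_ne_zero)
    rw [rootElement_pow, rootElement_pow, mul_one, mul_one]
    exact ⟨isConj_rootElement h h (by norm_num), isConj_rootElement h h (Nat.cast_ne_zero.2 hM.ne')⟩
  · rw [rootElement_pow, ringChar.Nat.cast_ringChar, zero_mul, rootElement_zero]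

/-- The transpose inverse, as an automorphism of the general linear group. -/
def transposeInv : GeneralLinearGroup (Fin n) F ≃* GeneralLinearGroup (Fin n) F where
  toFun g := ⟨(g⁻¹ : GeneralLinearGroup (Fin n) F).1ᵀ, g.1ᵀ, by
    rw [← transpose_mul, Units.mul_inv, transpose_one], by
    rw [← transpose_mul, Units.inv_mul, transpose_one]⟩
  invFun g := ⟨(g⁻¹ : GeneralLinearGroup (Fin n) F).1ᵀ, g.1ᵀ, by
    rw [← transpose_mul, Units.mul_inv, transpose_one], by
    rw [← transpose_mul, Units.inv_mul, transpose_one]⟩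
  left_inv g := by ext1; simp
  right_inv g := by ext1; simp
  map_mul' g h := by ext1; simp [transpose_mul]

lemma transposeInv_rootElement (i j : Fin n) (a : F) :
    transposeInv (rootElement i j a) = rootElement j i (-a) := by
  by_cases h : i = j
  · subst h
    rw [rootElement_self, rootElement_self, map_one]
  · ext1
    change ((rootElement i j a)⁻¹).1ᵀ = _
    rw [← rootElement_neg, coe_rootElement h, coe_rootElement (Ne.symm h), transpose_add,
      transpose_one, transpose_single]

end Matrix

/-! ### Root frames are unique up to automorphisms -/

/-- The group-theoretic description of the elementary transvections in `GLₙ` over a field of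
characteristic `c`. -/
structure IsRootFrame {G : Type*} [Group G] (c n : ℕ) (e : Fin n → Fin n → G) : Prop where
  steinberg : IsSteinbergSystem e
  diag (i : Fin n) : e i i = 1
  ne_one (i j : Fin n) : i ≠ j → e i j ≠ 1
  isConj (i j k l : Fin n) : i ≠ j → k ≠ l → IsConj (e i j) (e k l)
  unipotent (i j : Fin n) : i ≠ j → UnipotentCondition c n (e i j)

namespace Matrix

variable {n : ℕ} {F : Type*} [Field F]

lemma isRootFrame_rootElement :
    IsRootFrame (ringChar F) n fun i j => rootElement i j (1 : F) where
  steinberg := isSteinbergSystem_rootElement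
  diag i := rootElement_self i 1
  ne_one i j h h1 := one_ne_zero (rootElement_injective h (h1.trans (rootElement_zero i j).symm))
  isConj _ _ _ _ h h' := isConj_rootElement h h' one_ne_zero
  unipotent _ _ h := unipotentCondition_rootElement h

/-- The general linear group acting on column vectors. -/
noncomputable def columnRep : Representation F (GeneralLinearGroup (Fin n) F) (Fin n → F) :=
  (toLinAlgEquiv' : Matrix (Fin n) (Fin n) F ≃ₐ[F] _).toAlgHom.toRingHom.toMonoidHom.comp
    (Units.coeHom _)

lemma columnRep_apply (g : GeneralLinearGroup (Fin n) F) (v : Fin n → F) :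
    columnRep g v = g.1 *ᵥ v := rfl

lemma columnRep_injective :
    Function.Injective (columnRep : GeneralLinearGroup (Fin n) F → _) :=
  (toLinAlgEquiv' : Matrix (Fin n) (Fin n) F ≃ₐ[F] _).injective.comp Units.val_injective

/-- Elements that act as elementary transvections for some basis are conjugate to these. -/
lemma exists_conj_of_basis {e : Fin n → Fin n → GeneralLinearGroup (Fin n) F}
    (b : Module.Basis (Fin n) F (Fin n → F))
    (hb : ∀ i j k, i ≠ j → columnRep (e i j) (b k) = b k + if j = k then b i else 0) :
    ∃ P : GeneralLinearGroup (Fin n) F, ∀ i j, i ≠ j → P * rootElement i j 1 * P⁻¹ = e i j := by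
  let C : Matrix (Fin n) (Fin n) F := of fun r k => b k r
  have hC : IsUnit C := by
    rw [← linearIndependent_cols_iff_isUnit]
    exact b.linearIndependent
  have hcol (k : Fin n) : C *ᵥ Pi.single k 1 = b k := by
    ext r
    simp [C]
  refine ⟨hC.unit, fun i j hij => ?_⟩
  rw [mul_inv_eq_iff_eq_mul]
  refine columnRep_injective (LinearMap.pi_ext' fun k => LinearMap.ext_ring ?_)
  change (hC.unit * rootElement i j 1 : GeneralLinearGroup (Fin n) F).1 *ᵥ Pi.single k 1 =
    (e i j * hC.unit).1 *ᵥ Pi.single k 1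
  rw [Units.val_mul, Units.val_mul, ← mulVec_mulVec, ← mulVec_mulVec, IsUnit.unit_spec, hcol,
    ← columnRep_apply (e i j), hb i j k hij, coe_rootElement hij, add_mulVec, one_mulVec,
    mulVec_add, hcol, add_right_inj]
  split_ifs with hjk
  · subst hjk
    rw [← hcol i]
    congr 1
    ext r
    simp [single_apply, Pi.single_apply, eq_comm]
  · have : single i j (1 : F) *ᵥ Pi.single k 1 = 0 := by
      ext r
      simp [hjk]
    rw [this, mulVec_zero]

/-- All tuples satisfying the group-theoretic description are images of the elementary
transvections under automorphisms. -/
theorem exists_mulEquiv_of_isRootFrame (hn : 3 ≤ n)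
    {e : Fin n → Fin n → GeneralLinearGroup (Fin n) F} (he : IsRootFrame (ringChar F) n e) :
    ∃ θ : GeneralLinearGroup (Fin n) F ≃* GeneralLinearGroup (Fin n) F,
      ∀ i j, θ (rootElement i j 1) = e i j := by
  obtain ⟨m, rfl⟩ := Nat.exists_eq_add_of_le' hn
  have hι : Nat.card (Fin (m + 3)) = m + 3 := by simp
  have hV : Module.finrank F (Fin (m + 3) → F) = m + 3 := by simp
  have hu : ∀ i j, i ≠ j → IsNilpotent (columnRep (e i j) - 1) := by
    intro i j hij
    have := (isNilpotent_of_unipotentCondition (by omega) _ (he.unipotent i j hij)).map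
      (toLinAlgEquiv' : Matrix (Fin (m + 3)) (Fin (m + 3)) F ≃ₐ[F] _)
    rwa [map_sub, map_one] at this
  have h1 : ∀ i j, i ≠ j → columnRep (e i j) ≠ 1 := fun i j hij h =>
    he.ne_one i j hij (columnRep_injective (h.trans (map_one _).symm))
  have h01 : (0 : Fin (m + 3)) ≠ 1 := by simp
  rcases IsSteinbergSystem.finrank_rowFix hι hV he.steinberg hu ⟨0, 1, h01, h1 0 1 h01⟩ 0
    with h | h
  -- If the row has the hyperplane, the dual system has it for its column; this is where transpose
  -- inverse enters.
  · obtain ⟨b, hb⟩ := IsSteinbergSystem.exists_basis hι hV he.steinberg.dual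
      (IsSteinbergSystem.isNilpotent_dual hu) ⟨1, 0, h01.symm, fun h => by
        have := he.ne_one 0 1 h01
        exact this (inv_eq_one.1 (columnRep_injective (h.trans (map_one _).symm)))⟩ 0
      (fun j hj => by
        obtain ⟨c, hc⟩ := isConj_iff.1 (he.isConj 0 j j 0 hj.symm hj)
        exact isConj_iff.2 ⟨c, by rw [← hc]; group⟩) (by
        rw [show (fun i j => ((e i j)⁻¹)⁻¹) = e from by funext i j; simp]
        exact h)
    obtain ⟨P, hP⟩ := exists_conj_of_basis b hb
    refine ⟨transposeInv.trans (MulAut.conj P), fun i j => ?_⟩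
    by_cases hij : i = j
    · rw [hij, rootElement_self, map_one, he.diag]
    rw [MulEquiv.trans_apply, transposeInv_rootElement, rootElement_neg, map_inv, inv_eq_iff_eq_inv,
      ← hP j i (Ne.symm hij)]
    rfl
  · obtain ⟨b, hb⟩ := IsSteinbergSystem.exists_basis hι hV he.steinberg hu
      ⟨0, 1, h01, h1 0 1 h01⟩ 0 (fun j hj => he.isConj j 0 0 j hj hj.symm) h
    obtain ⟨P, hP⟩ := exists_conj_of_basis b hb
    refine ⟨MulAut.conj P, fun i j => ?_⟩
    by_cases hij : i = j
    · rw [hij, rootElement_self, map_one, he.diag]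
    exact hP i j hij

end Matrix

/-! ### Root frames in an elementarily equivalent group -/

/-- An isomorphism of groups is an isomorphism of structures for the language of groups. -/
def MulEquiv.toLanguageEquiv {G H : Type*} [Group G] [Group H] (θ : G ≃* H) :
    G ≃[groupLanguage] H where
  toEquiv := θ.toEquiv
  map_fun' f x := by
    cases f
    exacts [map_mul θ _ _, map_inv θ _, map_one θ]
  map_rel' r := r.elim

lemma MulEquiv.realize_formula {G H : Type*} [Group G] [Group H] (θ : G ≃* H) {V : Type*}
    (φ : groupLanguage.Formula V) (v : V → G) : φ.Realize (θ ∘ v) ↔ φ.Realize v :=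
  StrongHomClass.realize_formula θ.toLanguageEquiv φ

namespace Frame

variable {G H : Type*} [Group G] [Group H] {ι : Type} {F L : Type*} {S : Frame G H ι F L}
variable {α β : Type}

lemma Definable.relabelG {P : (α → G) × (β → F) → Prop} {Q : (α → H) × (β → L) → Prop}
    (h : S.Definable P Q) {α' : Type} (r : α → α') :
    S.Definable (fun γ => P (γ.1 ∘ r, γ.2)) (fun γ => Q (γ.1 ∘ r, γ.2)) := by
  obtain ⟨φ, h₁, h₂⟩ := h
  refine ⟨φ.relabel (Sum.map id (Sum.map r id)), fun γ => ?_, fun γ => ?_⟩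
  · rw [Formula.realize_relabel]
    refine Iff.trans (iff_of_eq (congrArg _ ?_)) (h₁ _)
    ext (i | a | b) <;> rfl
  · rw [Formula.realize_relabel]
    refine Iff.trans (iff_of_eq (congrArg _ ?_)) (h₂ _)
    ext (i | a | b) <;> rfl

lemma IsTerm.relabel {f : (α → G) × (β → F) → G} {g : (α → H) × (β → L) → H}
    (h : S.IsTerm f g) {α' β' : Type} (r : α → α') (s : β → β') :
    S.IsTerm (fun γ => f (γ.1 ∘ r, γ.2 ∘ s)) (fun γ => g (γ.1 ∘ r, γ.2 ∘ s)) := by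
  obtain ⟨t, h₁, h₂⟩ := h
  refine ⟨t.relabel (Sum.map id (Sum.map r s)), fun γ => ?_, fun γ => ?_⟩
  · rw [Term.realize_relabel]
    refine Eq.trans (congrArg (fun v => t.realize v) ?_) (h₁ _)
    ext (i | a | b) <;> rfl
  · rw [Term.realize_relabel]
    refine Eq.trans (congrArg (fun v => t.realize v) ?_) (h₂ _)
    ext (i | a | b) <;> rfl

lemma Definable.isConj {f f' : (α → G) × (β → F) → G} {g g' : (α → H) × (β → L) → H}
    (h : S.IsTerm f g) (h' : S.IsTerm f' g') :
    S.Definable (fun γ => IsConj (f γ) (f' γ)) (fun γ => IsConj (g γ) (g' γ)) :=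
  (existsG (P := fun γ x => x * f γ * x⁻¹ = f' γ) (Q := fun γ x => x * g γ * x⁻¹ = g' γ)
    (eq (((IsTerm.var (Sum.inr ())).mul (h.relabel Sum.inl id)).mul (IsTerm.var (Sum.inr ())).inv)
      (h'.relabel Sum.inl id))).congr
    (fun _ => isConj_iff.symm) (fun _ => isConj_iff.symm)

lemma definable_isRootFrame (c n : ℕ) :
    S.Definable (α := Fin n × Fin n) (β := β) (fun γ => IsRootFrame c n fun i j => γ.1 (i, j))
      (fun γ => IsRootFrame c n fun i j => γ.1 (i, j)) := by
  have hw (i j : Fin n) : S.IsTerm (α := Fin n × Fin n) (β := β)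
    (fun γ => γ.1 (i, j)) (fun γ => γ.1 (i, j)) := IsTerm.var _
  have hU (i j : Fin n) : S.Definable (α := Fin n × Fin n) (β := β)
      (fun γ => UnipotentCondition c n (γ.1 (i, j)))
      (fun γ => UnipotentCondition c n (γ.1 (i, j))) := by
    unfold UnipotentCondition
    split_ifs
    · exact (Definable.isConj (hw i j) ((hw i j).pow _)).and
        (Definable.isConj (hw i j) ((hw i j).pow _))
    · exact Definable.eq ((hw i j).pow _) IsTerm.one
  refine Definable.congr (Definable.and (Definable.and (Definable.and (Definable.and
    (Definable.and (Definable.and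
    (Definable.all fun i : Fin n => Definable.all fun j : Fin n =>
      Definable.all fun k : Fin n => Definable.all fun l : Fin n =>
      (Definable.prop (i ≠ j)).imp ((Definable.prop (k ≠ l)).imp
        ((Definable.prop (j ≠ k)).imp ((Definable.prop (i ≠ l)).imp
        (Definable.eq ((hw i j).mul (hw k l)) ((hw k l).mul (hw i j)))))))
    (Definable.all fun i : Fin n => Definable.all fun j : Fin n => Definable.all fun k : Fin n =>
      (Definable.prop (i ≠ j)).imp ((Definable.prop (j ≠ k)).imp ((Definable.prop (i ≠ k)).imp
        (Definable.eq ((hw i j).commutator (hw j k)) (hw i k))))))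
    (Definable.all fun i : Fin n => Definable.all fun j : Fin n =>
      (Definable.prop (i ≠ j)).imp (Definable.eq (((hw i j).mul (hw j i).inv).mul (hw i j))
        (((hw j i).inv.mul (hw i j)).mul (hw j i).inv))))
    (Definable.all fun i : Fin n => Definable.eq (hw i i) IsTerm.one))
    (Definable.all fun i : Fin n => Definable.all fun j : Fin n =>
      (Definable.prop (i ≠ j)).imp (Definable.eq (hw i j) IsTerm.one).not))
    (Definable.all fun i : Fin n => Definable.all fun j : Fin n =>
      Definable.all fun k : Fin n => Definable.all fun l : Fin n =>
      (Definable.prop (i ≠ j)).imp ((Definable.prop (k ≠ l)).imp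
        (Definable.isConj (hw i j) (hw k l)))))
    (Definable.all fun i : Fin n => Definable.all fun j : Fin n =>
      (Definable.prop (i ≠ j)).imp (hU i j)))
    (fun γ => ⟨fun h => ⟨⟨h.1.1.1.1.1.1 _ _ _ _, h.1.1.1.1.1.2 _ _ _, h.1.1.1.1.2 _ _⟩,
      h.1.1.1.2, h.1.1.2, h.1.2, h.2⟩, fun h => ⟨⟨⟨⟨⟨⟨fun _ _ _ _ => h.1.1, fun _ _ _ => h.1.2⟩,
      fun _ _ => h.1.3⟩, h.2⟩, h.3⟩, h.4⟩, h.5⟩⟩)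
    (fun γ => ⟨fun h => ⟨⟨h.1.1.1.1.1.1 _ _ _ _, h.1.1.1.1.1.2 _ _ _, h.1.1.1.1.2 _ _⟩,
      h.1.1.1.2, h.1.1.2, h.1.2, h.2⟩, fun h => ⟨⟨⟨⟨⟨⟨fun _ _ _ _ => h.1.1, fun _ _ _ => h.1.2⟩,
      fun _ _ => h.1.3⟩, h.2⟩, h.3⟩, h.4⟩, h.5⟩⟩)
end Frame

/-- A group that is elementarily equivalent to `GLₙ(F)` has elements that satisfy the same formulas
as the elementary transvections. -/
theorem GroupElemEquiv.exists_rootFrame {n : ℕ} (hn : 3 ≤ n) {F : Type*} [Field F] {H : Type*}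
    [Group H] (h : GroupElemEquiv H (Matrix.GeneralLinearGroup (Fin n) F)) :
    ∃ e : Fin n → Fin n → H, ∀ φ : groupLanguage.Formula (Fin n × Fin n),
      φ.Realize (fun p => (Matrix.rootElement p.1 p.2 1 : Matrix.GeneralLinearGroup (Fin n) F)) ↔
        φ.Realize (fun p => e p.1 p.2) := by
  let S : Frame (Matrix.GeneralLinearGroup (Fin n) F) H Empty Empty Empty :=
    ⟨Empty.elim, Empty.elim, Empty.elim, Empty.elim⟩
  have hS : S.Equivalent := fun φ => by
    have := elementarilyEquivalent_iff.1 h φ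
    refine Iff.trans ?_ (this.symm.trans ?_) <;>
    · refine iff_of_eq ?_
      unfold Sentence.Realize
      congr 1
      exact Subsingleton.elim _ _
  have hΦ := Frame.definable_isRootFrame (S := S) (β := Empty) (ringChar F) n
  -- "Every root frame satisfies `φ`" is a single sentence. It holds in `GL_n(F)`, where root frames
  -- are automorphic images of the standard one. Applied to the negation of `φ`, it gives the
  -- converse implication at the end.
  have key (φ : groupLanguage.Formula (Fin n × Fin n))
      (hφ : φ.Realize fun p =>
        (Matrix.rootElement p.1 p.2 1 : Matrix.GeneralLinearGroup (Fin n) F))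
      (e : Fin n × Fin n → H) (he : IsRootFrame (ringChar F) n fun i j => e (i, j)) :
      φ.Realize e := by
    have hd : S.Definable (α := Fin n × Fin n) (β := Empty) (fun γ => φ.Realize γ.1)
        (fun γ => φ.Realize γ.1) :=
      ⟨φ.relabel fun p => .inr (.inl p), fun γ => by rw [Formula.realize_relabel]; rfl,
        fun γ => by rw [Formula.realize_relabel]; rfl⟩
    have hall : S.Definable (α := Empty) (β := Empty)
        (fun _ => ∀ e : Fin n × Fin n → Matrix.GeneralLinearGroup (Fin n) F,
          IsRootFrame (ringChar F) n (fun i j => e (i, j)) → φ.Realize e)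
        (fun _ => ∀ e : Fin n × Fin n → H,
          IsRootFrame (ringChar F) n (fun i j => e (i, j)) → φ.Realize e) :=
      Frame.Definable.allTuple ((hΦ.imp hd).relabelG Sum.inr)
    refine (hS.iff hall).1 ?_ e he
    intro e he
    obtain ⟨θ, hθ⟩ := Matrix.exists_mulEquiv_of_isRootFrame hn he
    rw [← (funext fun p => hθ p.1 p.2 : (θ ∘ fun p => Matrix.rootElement p.1 p.2 1) = e)]
    exact (θ.realize_formula φ _).2 hφ
  have hex : S.Definable (α := Empty) (β := Empty)
      (fun _ => ∃ e : Fin n × Fin n → Matrix.GeneralLinearGroup (Fin n) F,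
        IsRootFrame (ringChar F) n fun i j => e (i, j))
      (fun _ => ∃ e : Fin n × Fin n → H, IsRootFrame (ringChar F) n fun i j => e (i, j)) :=
    Frame.Definable.exTuple (hΦ.relabelG Sum.inr)
  obtain ⟨e, he⟩ := (hS.iff hex).1
    ⟨fun p => Matrix.rootElement p.1 p.2 1, Matrix.isRootFrame_rootElement⟩
  refine ⟨fun i j => e (i, j), fun φ => ⟨fun hφ => key φ hφ e he, fun hφ => ?_⟩⟩
  by_contra hc
  exact (Formula.realize_not.1 (key (∼φ) (Formula.realize_not.2 hc) e he)) hφ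

namespace Matrix

/-! ### Bounded generation by transvections -/

section BoundedGeneration

open Sum TransvectionStruct Pivot

variable {K : Type*} [Field K] {r : ℕ}

/-- Another nonzero entry of the last column corrects the corner by one row operation. If there is
none, the corner is nonzero, and one further row operation creates such an entry. -/
lemma exists_list_transvec_mul_corner_eq_one [NeZero r] (M : Matrix (Fin r ⊕ Unit) (Fin r ⊕ Unit) K)
    (hM : M.det = 1) : ∃ L : List (TransvectionStruct (Fin r ⊕ Unit) K), L.length ≤ 2 ∧
      ((L.map toMatrix).prod * M) (inr ()) (inr ()) = 1 := by
  have key (M : Matrix (Fin r ⊕ Unit) (Fin r ⊕ Unit) K) (i : Fin r)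
      (h : M (inl i) (inr ()) ≠ 0) : (transvection (inr ()) (inl i)
        ((1 - M (inr ()) (inr ())) / M (inl i) (inr ())) * M) (inr ()) (inr ()) = 1 := by
    rw [transvection_mul_apply_same, div_mul_cancel₀ _ h, add_sub_cancel]
  by_cases h : ∃ i, M (inl i) (inr ()) ≠ 0
  · obtain ⟨i, hi⟩ := h
    exact ⟨[⟨inr (), inl i, by simp, (1 - M (inr ()) (inr ())) / M (inl i) (inr ())⟩], by simp, by
      simpa using key M i hi⟩
  · push Not at h
    have hc : M (inr ()) (inr ()) ≠ 0 := fun hc => by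
      refine one_ne_zero (hM.symm.trans (det_eq_zero_of_column_eq_zero (inr ()) ?_))
      rintro (i | i)
      exacts [h i, hc]
    let M' := transvection (inl (0 : Fin r)) (inr ()) (1 : K) * M
    have h0 : M' (inl 0) (inr ()) ≠ 0 := by
      dsimp only [M']
      rwa [transvection_mul_apply_same, h, zero_add, one_mul]
    refine ⟨[⟨inr (), inl 0, by simp, (1 - M' (inr ()) (inr ())) / M' (inl 0) (inr ())⟩,
      ⟨inl 0, inr (), by simp, 1⟩], by simp, ?_⟩
    simpa [M', Matrix.mul_assoc] using key M' 0 h0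

lemma exists_list_transvec_mul_mul_list_transvec_eq_fromBlocks
    (M : Matrix (Fin r ⊕ Unit) (Fin r ⊕ Unit) K) (hM : M (inr ()) (inr ()) = 1) :
    ∃ (L L' : List (TransvectionStruct (Fin r ⊕ Unit) K)) (N : Matrix (Fin r) (Fin r) K),
      L.length ≤ r ∧ L'.length ≤ r ∧
      (L.map toMatrix).prod * M * (L'.map toMatrix).prod = fromBlocks N 0 0 1 := by
  let L : List (TransvectionStruct (Fin r ⊕ Unit) K) := List.ofFn fun i : Fin r =>
    ⟨inl i, inr (), by simp, -M (inl i) (inr ()) / M (inr ()) (inr ())⟩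
  let L' : List (TransvectionStruct (Fin r ⊕ Unit) K) := List.ofFn fun i : Fin r =>
    ⟨inr (), inl i, by simp, -M (inr ()) (inl i) / M (inr ()) (inr ())⟩
  have hL : L.map toMatrix = listTransvecCol M := by simp [L, listTransvecCol, Function.comp_def]
  have hL' : L'.map toMatrix = listTransvecRow M := by simp [L', listTransvecRow, Function.comp_def]
  have hb := isTwoBlockDiagonal_listTransvecCol_mul_mul_listTransvecRow M (by simp [hM])
  refine ⟨L, L',
    toBlocks₁₁ ((listTransvecCol M).prod * M * (listTransvecRow M).prod), by simp [L],
    by simp [L'], ?_⟩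
  rw [hL, hL']
  refine (fromBlocks_toBlocks _).symm.trans ?_
  rw [hb.1, hb.2]
  have hrow : listTransvecRow M = listTransvecRow ((listTransvecCol M).prod * M) := by
    simp [listTransvecRow, listTransvecCol_mul_last_row]
  congr 1
  ext
  rw [toBlocks₂₂, of_apply, hrow, mul_listTransvecRow_last_col, listTransvecCol_mul_last_row, hM]
  rfl

/-- Elimination with the corner made 1 at each stage leaves the identity instead of a diagonal
matrix. What matters is a bound that depends on the size only, so that the factors can be quantified
in one formula. -/
lemma exists_list_transvec_mul_mul_list_transvec_eq_one (M : Matrix (Fin r) (Fin r) K)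
    (hM : M.det = 1) : ∃ L L' : List (TransvectionStruct (Fin r) K),
      L.length ≤ (r + 1) ^ 2 ∧ L'.length ≤ (r + 1) ^ 2 ∧
      (L.map toMatrix).prod * M * (L'.map toMatrix).prod = 1 := by
  induction r with
  | zero => exact ⟨[], [], by simp, by simp, Subsingleton.elim _ _⟩
  | succ r ih =>
    rcases Nat.eq_zero_or_pos r with rfl | hr
    · refine ⟨[], [], by simp, by simp, ?_⟩
      ext i j
      rw [det_fin_one] at hM
      obtain rfl : i = 0 := Fin.fin_one_eq_zero i
      obtain rfl : j = 0 := Fin.fin_one_eq_zero j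
      simpa using hM
    have := NeZero.of_pos hr
    let e : Fin (r + 1) ≃ Fin r ⊕ Unit := Fintype.equivOfCardEq (by simp)
    let M₁ := reindexAlgEquiv K K e M
    have hM₁ : M₁.det = 1 := by simpa [M₁] using hM
    obtain ⟨L₁, hL₁, h₁⟩ := exists_list_transvec_mul_corner_eq_one M₁ hM₁
    obtain ⟨L₂, L₂', N, hL₂, hL₂', h₂⟩ :=
      exists_list_transvec_mul_mul_list_transvec_eq_fromBlocks _ h₁
    have hN : N.det = 1 := by
      have := congrArg det h₂
      simpa [hM₁] using this.symm
    obtain ⟨L₃, L₃', hL₃, hL₃', h₃⟩ := ih N hN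
    refine ⟨((L₃.map (sumInl Unit)) ++ L₂ ++ L₁).map (reindexEquiv e.symm),
      (L₂' ++ L₃'.map (sumInl Unit)).map (reindexEquiv e.symm), ?_, ?_, ?_⟩
    · simp only [List.length_map, List.length_append]
      nlinarith
    · simp only [List.length_map, List.length_append]
      nlinarith
    · have hM : M = reindexAlgEquiv K K e.symm M₁ := by simp [M₁]
      rw [hM, List.map_map, List.map_map, toMatrix_reindexEquiv_prod, toMatrix_reindexEquiv_prod,
        ← map_mul, ← map_mul, ← map_one (reindexAlgEquiv K K e.symm)]
      congr 1
      have h₄ : ((L₃.map (sumInl Unit) ++ L₂ ++ L₁).map toMatrix).prod * M₁ *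
          ((L₂' ++ L₃'.map (sumInl Unit)).map toMatrix).prod =
          ((L₃.map (sumInl Unit)).map toMatrix).prod * ((L₂.map toMatrix).prod *
          ((L₁.map toMatrix).prod * M₁) * (L₂'.map toMatrix).prod) *
          ((L₃'.map (sumInl Unit)).map toMatrix).prod := by
        simp only [List.map_append, List.prod_append, Matrix.mul_assoc]
      rw [h₄, h₂, List.map_map, List.map_map]
      rw [sumInl_toMatrix_prod_mul, mul_sumInl_toMatrix_prod, h₃, fromBlocks_one]

/-- The bound for the number of transvections that are needed to write a matrix of determinant
one. -/
def transvectionBound (n : ℕ) : ℕ := 2 * (n + 1) ^ 2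

lemma exists_list_rootElement [NeZero r] (M : GeneralLinearGroup (Fin r) K) (hM : M.1.det = 1) :
    ∃ (p : Fin (transvectionBound r) → Fin r × Fin r) (w : Fin (transvectionBound r) → K),
      M = (List.ofFn fun k => rootElement (p k).1 (p k).2 (w k)).prod := by
  obtain ⟨L, L', hL, hL', h⟩ := exists_list_transvec_mul_mul_list_transvec_eq_one M.1 hM
  have key (L : List (TransvectionStruct (Fin r) K)) :
      (L.map fun t => rootElement t.i t.j t.c).prod.1 = (L.map toMatrix).prod := by
    rw [← Units.coeHom_apply, map_list_prod, List.map_map]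
    congr 2
    funext t
    exact coe_rootElement t.hij t.c
  have h' : M = (L.reverse.map fun t => rootElement t.inv.i t.inv.j t.inv.c).prod *
      (L'.reverse.map fun t => rootElement t.inv.i t.inv.j t.inv.c).prod := by
    have hinv (L : List (TransvectionStruct (Fin r) K)) :
        (L.reverse.map fun t => rootElement t.inv.i t.inv.j t.inv.c).prod =
          (L.map fun t => rootElement t.i t.j t.c).prod⁻¹ := by
      rw [List.prod_inv_reverse, List.map_reverse, List.map_map]
      congr 3
      funext t
      exact rootElement_neg _ _ _
    rw [hinv, hinv, eq_inv_mul_iff_mul_eq, eq_inv_iff_mul_eq_one]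
    ext1
    rw [Units.val_mul, Units.val_mul, key, key, h, Units.val_one]
  let l := (L.reverse ++ L'.reverse).map fun t => (t.inv.i, t.inv.j, t.inv.c)
  have hl : l.length ≤ transvectionBound r := by
    simp only [l, List.length_map, List.length_append, List.length_reverse, transvectionBound]
    omega
  let f : Fin r × Fin r × K → GeneralLinearGroup (Fin r) K := fun t => rootElement t.1 t.2.1 t.2.2
  have hM' : M = (l.map f).prod := by
    rw [h', List.map_map, List.map_append, List.prod_append]
    rfl
  -- Padding to a fixed length is possible since the root element at a diagonal position is 1.
  let l' := l ++ List.replicate (transvectionBound r - l.length) (0, 0, 0)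
  have hl' : l'.length = transvectionBound r := by simp [l']; omega
  have hM'' : M = (l'.map f).prod := by
    rw [hM', List.map_append, List.prod_append, List.map_replicate, List.prod_replicate]
    simp [f, rootElement_self]
  clear_value l'
  refine ⟨fun k => ((l'.get (k.cast hl'.symm)).1, (l'.get (k.cast hl'.symm)).2.1),
    fun k => (l'.get (k.cast hl'.symm)).2.2, ?_⟩
  generalize transvectionBound r = N at hl'
  subst hl'
  rw [hM'']
  congr 1
  conv_lhs => rw [← List.ofFn_get l', List.map_ofFn]
  rfl

end BoundedGeneration
end Matrix

/-! ### The field in a root group -/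

section Words

variable {m : ℕ} {G : Type*} [Group G] (e : Fin (m + 3) → Fin (m + 3) → G)

/-- The element at position `(0, j)` with the same entry as `x` at position `(0, 1)`. -/
def rowWord (j : Fin (m + 3)) (x : G) : G := if j = 1 then x else ⁅x, e 1 j⁆

/-- The element at position `(i, j)` with the same entry as `x` at position `(0, 1)`. -/
def rootWord (i j : Fin (m + 3)) (x : G) : G :=
  if i = j then 1 else if i = 0 then rowWord e j x else if j ≠ 0 then ⁅e i 0, rowWord e j x⁆ else
    -- The route through column 0 cannot end in column 0, so the entry returns there through an
    -- auxiliary index, 2 or 1, different from `i`.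
    if i = 1 then ⁅⁅e i 0, rowWord e 2 x⁆, e 2 0⁆ else ⁅⁅e i 0, rowWord e 1 x⁆, e 1 0⁆

/-- The product of entries at position `(0, 1)`. -/
def mulWord (x y : G) : G := ⁅⁅x, rootWord e 1 2 y⁆, e 2 1⁆

/-- The group-theoretic description of the root group at position `(0, 1)`. -/
def IsFirstRoot (x : G) : Prop :=
  ∃ y, (∀ k l, k ≠ 2 → l ≠ 0 → k ≠ l → y * e k l = e k l * y) ∧ x = ⁅y, e 2 1⁆

/-- The group-theoretic description of the arithmetic of the entries at position `(0, 1)`. -/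
structure IsRootEmbedding {K : Type*} [Zero K] [One K] [Add K] [Neg K] [Mul K] (emb : K → G) :
    Prop where
  injective : Function.Injective emb
  mem_range (x : G) : x ∈ Set.range emb ↔ IsFirstRoot e x
  zero : emb 0 = 1
  one : emb 1 = e 0 1
  add (a b : K) : emb (a + b) = emb a * emb b
  neg (a : K) : emb (-a) = (emb a)⁻¹
  mul (a b : K) : emb (a * b) = mulWord e (emb a) (emb b)

end Words

lemma Fin.zero_ne_two_of_three {m : ℕ} : (0 : Fin (m + 3)) ≠ 2 := by
  simp [Fin.ext_iff, Nat.mod_eq_of_lt (show 2 < m + 3 by omega)]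

lemma Fin.one_ne_two_of_three {m : ℕ} : (1 : Fin (m + 3)) ≠ 2 := by
  simp [Fin.ext_iff, Nat.mod_eq_of_lt (show 2 < m + 3 by omega)]

namespace Matrix

variable {m : ℕ} {F : Type*} [Field F]

lemma rowWord_rootElement {j : Fin (m + 3)} (hj : j ≠ 0) (a : F) :
    rowWord (fun i j => rootElement i j (1 : F)) j (rootElement 0 1 a) = rootElement 0 j a := by
  unfold rowWord
  split_ifs with h
  · rw [h]
  · rw [commutator_rootElement (by simp) (Ne.symm h) hj.symm, mul_one]

lemma rootWord_rootElement (i j : Fin (m + 3)) (a : F) :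
    rootWord (fun i j => rootElement i j (1 : F)) i j (rootElement 0 1 a) = rootElement i j a := by
  have h02 := Fin.zero_ne_two_of_three (m := m)
  unfold rootWord
  split_ifs with hij hi hj hi'
  · rw [hij, rootElement_self]
  · rw [hi] at hij ⊢
    rw [rowWord_rootElement (Ne.symm hij)]
  · rw [rowWord_rootElement hj, commutator_rootElement hi hj.symm hij, one_mul]
  · rw [not_not] at hj
    have hi2 : i ≠ 2 := hi' ▸ Fin.one_ne_two_of_three
    rw [rowWord_rootElement h02.symm, commutator_rootElement hi h02 hi2, hj,
      commutator_rootElement hi2 h02.symm hi, one_mul, mul_one]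
  · rw [not_not] at hj
    have h01 : (0 : Fin (m + 3)) ≠ 1 := by simp
    rw [rowWord_rootElement h01.symm, commutator_rootElement hi h01 hi', hj,
      commutator_rootElement hi' h01.symm hi, one_mul, mul_one]

lemma mulWord_rootElement (a b : F) :
    mulWord (fun i j : Fin (m + 3) => rootElement i j (1 : F)) (rootElement 0 1 a)
      (rootElement 0 1 b) = rootElement 0 1 (a * b) := by
  have h01 : (0 : Fin (m + 3)) ≠ 1 := by simp
  rw [mulWord, rootWord_rootElement, commutator_rootElement h01 Fin.one_ne_two_of_three
    Fin.zero_ne_two_of_three, commutator_rootElement Fin.zero_ne_two_of_three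
    Fin.one_ne_two_of_three.symm h01, mul_one]

lemma commute_rootElement_one_iff {n : ℕ} {k l : Fin n} (h : k ≠ l)
    (y : GeneralLinearGroup (Fin n) F) :
    y * rootElement k l 1 = rootElement k l 1 * y ↔
      y.1 * single k l 1 = single k l 1 * y.1 := by
  rw [← Units.val_inj, Units.val_mul, Units.val_mul, coe_rootElement h, mul_add, add_mul, mul_one,
    one_mul, add_right_inj]

/-- The commutation conditions force `y` to be a scalar `c` plus an entry `b` at `(0, 2)`. The
commutator with `e 2 1` removes the scalar and leaves the entry `b / c` at `(0, 1)`. -/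
lemma isFirstRoot_iff (x : GeneralLinearGroup (Fin (m + 3)) F) :
    IsFirstRoot (fun i j => rootElement i j (1 : F)) x ↔ ∃ a, rootElement 0 1 a = x := by
  have h02 := Fin.zero_ne_two_of_three (m := m)
  have h12 := Fin.one_ne_two_of_three (m := m)
  have h01 : (0 : Fin (m + 3)) ≠ 1 := by simp
  constructor
  · rintro ⟨y, hy, rfl⟩
    have hc (k l : Fin (m + 3)) (hk : k ≠ 2) (hl : l ≠ 0) (hkl : k ≠ l) :
        Commute (single k l 1) y.1 :=
      ((commute_rootElement_one_iff hkl y).1 (hy k l hk hl hkl)).symm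
    have hcol (k r : Fin (m + 3)) (hk : k ≠ 2) (hr : r ≠ k) : y.1 r k = 0 := by
      obtain ⟨l, hl0, hlk⟩ := exists_ne_ne_of_two_lt_card (by simp) 0 k
      exact col_eq_zero_of_commute_single (hc k l hk hl0 hlk.symm) hr
    have hdiag (k l : Fin (m + 3)) (hk : k ≠ 2) (hl : l ≠ 0) (hkl : k ≠ l) : y.1 k k = y.1 l l := by
      exact diag_eq_of_commute_single (hc k l hk hl hkl)
    have hrow (l s : Fin (m + 3)) (hl : l ≠ 0) (hs : s ≠ l) : y.1 l s = 0 := by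
      obtain ⟨k, hk2, hkl⟩ := exists_ne_ne_of_two_lt_card (by simp) 2 l
      exact row_eq_zero_of_commute_single (hc k l hk2 hl hkl) hs
    set c := y.1 0 0
    set b := y.1 0 2
    have hy1 : y.1 = c • 1 + single 0 2 b := by
      ext r s
      by_cases hrs : r = s
      · subst hrs
        have : y.1 r r = c := by
          by_cases hr : r = 0
          · rw [hr]
          · exact (hdiag 0 r h02 hr (Ne.symm hr)).symm
        have h' : ¬ (0 = r ∧ 2 = r) := fun h => h02 (h.1.trans h.2.symm)
        simp [this, h']
      · by_cases h : r = 0 ∧ s = 2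
        · rw [h.1, h.2]
          simp [h02, b]
        · have : y.1 r s = 0 := by
            by_cases hr : r = 0
            · exact hcol s r (fun hs => h ⟨hr, hs⟩) hrs
            · exact hrow r s hr (Ne.symm hrs)
          have h' : ¬ (0 = r ∧ 2 = s) := fun h' => h ⟨h'.1.symm, h'.2.symm⟩
          simp [this, h', one_apply_ne hrs]
    have hc0 : c ≠ 0 := fun h0 => by
      have hdet : y.1.det = 0 := det_eq_zero_of_row_eq_zero 1 fun s => by
        rw [hy1, h0]
        simp [h01]
      exact (isUnit_iff_isUnit_det y.1).1 y.isUnit |>.ne_zero hdet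
    refine ⟨b / c, ?_⟩
    rw [commutatorElement_def, eq_mul_inv_iff_mul_eq, eq_mul_inv_iff_mul_eq]
    ext1
    simp only [Units.val_mul, coe_rootElement h01, coe_rootElement h12.symm, hy1]
    simp only [mul_add, add_mul, mul_one, one_mul, smul_mul_assoc, mul_smul_comm,
      single_mul_single_same, single_mul_single_of_ne _ _ _ _ h01.symm,
      single_mul_single_of_ne _ _ _ _ h12, smul_add, smul_single, smul_eq_mul,
      add_zero, mul_div_cancel₀ b hc0]
    abel
  · rintro ⟨a, rfl⟩
    refine ⟨rootElement 0 2 a, fun k l hk hl _ => commute_rootElement hk.symm hl.symm _ _, ?_⟩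
    rw [commutator_rootElement h02 h12.symm h01, mul_one]

lemma isRootEmbedding_rootElement :
    IsRootEmbedding (fun i j : Fin (m + 3) => rootElement i j (1 : F)) (rootElement 0 1) where
  injective := rootElement_injective (by simp)
  mem_range x := (isFirstRoot_iff x).symm
  zero := rootElement_zero 0 1
  one := rfl
  add := rootElement_add 0 1
  neg := rootElement_neg 0 1
  mul a b := (mulWord_rootElement a b).symm

end Matrix

namespace Frame

variable {m : ℕ} {G H : Type*} [Group G] [Group H] {K L : Type*}

/-- The frame given by the elements `e i j` as constants. -/
abbrev ofRoots (e : Fin (m + 3) → Fin (m + 3) → G) (e' : Fin (m + 3) → Fin (m + 3) → H)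
    (emb : K → G) (emb' : L → H) : Frame G H (Fin (m + 3) × Fin (m + 3)) K L :=
  ⟨fun p => e p.1 p.2, fun p => e' p.1 p.2, emb, emb'⟩

variable {e : Fin (m + 3) → Fin (m + 3) → G} {e' : Fin (m + 3) → Fin (m + 3) → H}
  {emb : K → G} {emb' : L → H} {α β : Type}

namespace IsTerm

lemma root (i j : Fin (m + 3)) : (ofRoots e e' emb emb').IsTerm (α := α) (β := β)
    (fun _ => e i j) (fun _ => e' i j) := const (i, j)

variable {f f' : (α → G) × (β → K) → G} {g g' : (α → H) × (β → L) → H}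

lemma rowWord (j : Fin (m + 3)) (h : (ofRoots e e' emb emb').IsTerm f g) :
    (ofRoots e e' emb emb').IsTerm (fun γ => rowWord e j (f γ)) (fun γ => rowWord e' j (g γ)) := by
  unfold _root_.rowWord
  split_ifs
  exacts [h, h.commutator (root 1 j)]

lemma rootWord (i j : Fin (m + 3)) (h : (ofRoots e e' emb emb').IsTerm f g) :
    (ofRoots e e' emb emb').IsTerm (fun γ => rootWord e i j (f γ))
      (fun γ => rootWord e' i j (g γ)) := by
  unfold _root_.rootWord
  split_ifs
  exacts [one, h.rowWord j, (root i 0).commutator (h.rowWord j),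
    ((root i 0).commutator (h.rowWord 2)).commutator (root 2 0),
    ((root i 0).commutator (h.rowWord 1)).commutator (root 1 0)]

lemma mulWord (h : (ofRoots e e' emb emb').IsTerm f g) (h' : (ofRoots e e' emb emb').IsTerm f' g') :
    (ofRoots e e' emb emb').IsTerm (fun γ => mulWord e (f γ) (f' γ))
      (fun γ => mulWord e' (g γ) (g' γ)) :=
  (h.commutator (h'.rootWord 1 2)).commutator (root 2 1)

end IsTerm

lemma definable_isFirstRoot : (ofRoots e e' emb emb').Definable (α := Unit) (β := β)
    (fun γ => IsFirstRoot e (γ.1 ())) (fun γ => IsFirstRoot e' (γ.1 ())) := by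
  refine Definable.existsG (Definable.and (Definable.all fun k : Fin (m + 3) =>
    Definable.all fun l : Fin (m + 3) => (Definable.prop _).imp ((Definable.prop _).imp
    ((Definable.prop _).imp (Definable.eq ((IsTerm.var _).mul (IsTerm.root k l))
    ((IsTerm.root k l).mul (IsTerm.var _)))))) (Definable.eq (IsTerm.var (Sum.inl ()))
    ((IsTerm.var _).commutator (IsTerm.root 2 1))))

lemma sorted_ofRoots (hG : Function.Injective emb) (hH : Function.Injective emb')
    (hG' : ∀ x, x ∈ Set.range emb ↔ IsFirstRoot e x)
    (hH' : ∀ x, x ∈ Set.range emb' ↔ IsFirstRoot e' x) : (ofRoots e e' emb emb').Sorted :=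
  ⟨hG, hH, definable_isFirstRoot.congr (fun _ => (hG' _).symm) (fun _ => (hH' _).symm)⟩

/-- Operations on the second sort over `G` that are given by terms carry over to `H`. -/
lemma exists_op {ι : Type} {S : Frame G H ι K L} (hE : S.Equivalent) (hS : S.Sorted) {k : ℕ}
    {f : (Fin k → K) → K} {g : (Fin k → L) → H}
    (h : S.IsTerm (α := Empty) (β := Fin k) (fun γ => S.embG (f γ.2)) (fun γ => g γ.2)) :
    ∃ f' : (Fin k → L) → L, ∀ x, S.embH (f' x) = g x := by
  have := (hE.iff (Definable.allSTuple hS (κ := Fin k)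
    (P := fun _ x => ∃ y, S.embG y = S.embG (f x)) (Q := fun _ x => ∃ y, S.embH y = g x)
    (Definable.existsS hS (Definable.eq
      (IsSTerm.var (Sum.inr ()))
      (h.relabel (Empty.elim : Empty → Empty) (fun i => Sum.inl (Sum.inr i))))))).1
      fun x => ⟨f x, rfl⟩
  exact ⟨fun x => (this x).choose, fun x => (this x).choose_spec⟩

end Frame

namespace Frame

variable {m : ℕ} {G H : Type*} [Group G] [Group H] {K L : Type*}
variable {e : Fin (m + 3) → Fin (m + 3) → G} {e' : Fin (m + 3) → Fin (m + 3) → H}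
  {emb : K → G} {emb' : L → H} {α β : Type}

section Ring

variable [Zero K] [One K] [Add K] [Neg K] [Mul K] [Zero L] [One L] [Add L] [Neg L] [Mul L]

lemma IsRootEmbedding.sorted (hG : IsRootEmbedding e emb) (hH : IsRootEmbedding e' emb') :
    (ofRoots e e' emb emb').Sorted :=
  sorted_ofRoots hG.injective hH.injective hG.mem_range hH.mem_range

/-- Only the operations are compared and no ring axioms are assumed, so this applies before `L` is
known to be a field. -/
theorem ring_elementarilyEquivalent (hE : (ofRoots e e' emb emb').Equivalent)
    (hG : IsRootEmbedding e emb) (hH : IsRootEmbedding e' emb') :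
    letI := FirstOrder.Ring.compatibleRingOfRing K
    letI := FirstOrder.Ring.compatibleRingOfRing L
    FirstOrder.Language.ring.ElementarilyEquivalent K L := by
  let := FirstOrder.Ring.compatibleRingOfRing K
  let := FirstOrder.Ring.compatibleRingOfRing L
  refine elementarilyEquivalent hE (IsRootEmbedding.sorted hG hH)
    (fun k => inferInstance) fun k f => ?_
  cases f with
  | add =>
    change (ofRoots e e' emb emb').IsTerm (fun γ => emb (γ.2 0 + γ.2 1))
      (fun γ => emb' (γ.2 0 + γ.2 1))
    simp only [hG.add, hH.add]
    exact (IsSTerm.var 0).mul (IsSTerm.var 1)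
  | mul =>
    change (ofRoots e e' emb emb').IsTerm (fun γ => emb (γ.2 0 * γ.2 1))
      (fun γ => emb' (γ.2 0 * γ.2 1))
    simp only [hG.mul, hH.mul]
    exact IsTerm.mulWord (IsSTerm.var 0) (IsSTerm.var 1)
  | neg =>
    change (ofRoots e e' emb emb').IsTerm (fun γ => emb (- γ.2 0)) (fun γ => emb' (- γ.2 0))
    simp only [hG.neg, hH.neg]
    exact (IsSTerm.var 0).inv
  | zero =>
    change (ofRoots e e' emb emb').IsTerm (fun _ => emb 0) (fun _ => emb' 0)
    simp only [hG.zero, hH.zero]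
    exact IsTerm.one
  | one =>
    change (ofRoots e e' emb emb').IsTerm (fun _ => emb 1) (fun _ => emb' 1)
    simp only [hG.one, hH.one]
    exact IsTerm.root 0 1

end Ring

/-- The root group at position `(0, 1)` is the additive group of a field. -/
theorem exists_field {F : Type u} [Field F] {H : Type v} [Group H] {emb : F → G}
    (hG : IsRootEmbedding e emb)
    {e' : Fin (m + 3) → Fin (m + 3) → H}
    (hE : (ofRoots (L := {x // IsFirstRoot e' x}) e e' emb Subtype.val).Equivalent) :
    ∃ (L : Type v) (_ : Field L) (emb' : L → H), IsRootEmbedding e' emb' ∧ FieldElemEquiv L F := by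
  let L := {x // IsFirstRoot e' x}
  let emb' : L → H := Subtype.val
  have hS : (ofRoots e e' emb emb').Sorted := sorted_ofRoots hG.injective Subtype.val_injective
    hG.mem_range fun x => by simp [emb', L]
  obtain ⟨zero, hzero⟩ := exists_op (k := 0) hE hS (f := fun _ => 0) (g := fun _ => 1)
    (by simp only [hG.zero]; exact IsTerm.one)
  obtain ⟨one, hone⟩ := exists_op (k := 0) hE hS (f := fun _ => 1) (g := fun _ => e' 0 1)
    (by simp only [hG.one]; exact IsTerm.root 0 1)
  obtain ⟨add, hadd⟩ := exists_op (k := 2) hE hS (f := fun x => x 0 + x 1)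
    (g := fun x => emb' (x 0) * emb' (x 1))
    (by simp only [hG.add]; exact (IsSTerm.var 0).mul (IsSTerm.var 1))
  obtain ⟨neg, hneg⟩ := exists_op (k := 1) hE hS (f := fun x => - x 0)
    (g := fun x => (emb' (x 0))⁻¹) (by simp only [hG.neg]; exact (IsSTerm.var 0).inv)
  obtain ⟨mul, hmul⟩ := exists_op (k := 2) hE hS (f := fun x => x 0 * x 1)
    (g := fun x => mulWord e' (emb' (x 0)) (emb' (x 1)))
    (by simp only [hG.mul]; exact IsTerm.mulWord (IsSTerm.var 0) (IsSTerm.var 1))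
  let : Zero L := ⟨zero Fin.elim0⟩
  let : One L := ⟨one Fin.elim0⟩
  let : Add L := ⟨fun a b => add ![a, b]⟩
  let : Neg L := ⟨fun a => neg ![a]⟩
  let : Mul L := ⟨fun a b => mul ![a, b]⟩
  have hH : IsRootEmbedding e' emb' :=
    { injective := Subtype.val_injective
      mem_range := fun x => by simp [emb', L]
      zero := hzero _
      one := hone _
      add := fun a b => hadd _
      neg := fun a => hneg _
      mul := fun a b => hmul _ }
  let := FirstOrder.Ring.compatibleRingOfRing F
  let := FirstOrder.Ring.compatibleRingOfRing L
  -- The field axioms for `L` are first-order and are inherited from `F`.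
  have hFL : FirstOrder.Language.ring.ElementarilyEquivalent F L :=
    ring_elementarilyEquivalent hE hG hH
  have : L ⊨ Theory.field := hFL.theory_model
  let : Field L := FirstOrder.Field.fieldOfModelField L
  have hH' : IsRootEmbedding e' emb' := hH
  exact ⟨L, inferInstance, emb', hH', (ring_elementarilyEquivalent hE hG hH').symm⟩

end Frame

/-! ### The derived subgroup as a special linear group -/

namespace Matrix

variable {n : ℕ} {K : Type*} [Field K]

lemma det_rootElement (i j : Fin n) (a : K) : (rootElement i j a).1.det = 1 := by
  by_cases h : i = j
  · rw [h, rootElement_self, Units.val_one, det_one]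
  · rw [rootElement, dif_pos h]
    exact (SpecialLinearGroup.transvection h a).det_coe

end Matrix

section

variable {m : ℕ}

/-- The group generated by symbols for elementary transvections, mapped to the general linear
group. -/
noncomputable def matrixHom (K : Type*) [Field K] :
    FreeGroup ((Fin (m + 3) × Fin (m + 3)) × K) →* Matrix.GeneralLinearGroup (Fin (m + 3)) K :=
  FreeGroup.lift fun t => Matrix.rootElement t.1.1 t.1.2 t.2

/-- The group generated by symbols for elementary transvections, mapped to a group where these are
given by words. -/
def wordHom {K G : Type*} [Group G] (e : Fin (m + 3) → Fin (m + 3) → G) (emb : K → G) :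
    FreeGroup ((Fin (m + 3) × Fin (m + 3)) × K) →* G :=
  FreeGroup.lift fun t => rootWord e t.1.1 t.1.2 (emb t.2)

lemma range_matrixHom (K : Type*) [Field K] :
    (matrixHom (m := m) K).range =
      (Matrix.SpecialLinearGroup.toGL : Matrix.SpecialLinearGroup (Fin (m + 3)) K →* _).range := by
  apply le_antisymm
  · refine FreeGroup.range_lift_le ?_
    rintro _ ⟨t, rfl⟩
    exact ⟨⟨_, Matrix.det_rootElement t.1.1 t.1.2 t.2⟩, Units.ext rfl⟩
  · rintro _ ⟨M, rfl⟩
    obtain ⟨p, w, h⟩ := Matrix.exists_list_rootElement M.toGL M.2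
    change M.toGL ∈ _
    rw [h]
    refine Subgroup.list_prod_mem _ fun x hx => ?_
    obtain ⟨k, rfl⟩ := (List.mem_ofFn' _ _).1 hx
    exact ⟨FreeGroup.of (p k, w k), FreeGroup.lift_apply_of⟩

end

namespace Frame

variable {m : ℕ} {G H : Type*} [Group G] [Group H] {K L : Type*} [Field K] [Field L]
variable {e : Fin (m + 3) → Fin (m + 3) → G} {e' : Fin (m + 3) → Fin (m + 3) → H}
  {emb : K → G} {emb' : L → H} {α β : Type}
  (hG : IsRootEmbedding e emb) (hH : IsRootEmbedding e' emb')

namespace IsSTerm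

variable {f f' : (α → G) × (β → K) → K} {g g' : (α → H) × (β → L) → L}

include hG hH

lemma zero : (ofRoots e e' emb emb').IsSTerm (α := α) (β := β) (fun _ => 0) (fun _ => 0) := by
  simpa only [IsSTerm, hG.zero, hH.zero] using IsTerm.one

lemma one : (ofRoots e e' emb emb').IsSTerm (α := α) (β := β) (fun _ => 1) (fun _ => 1) := by
  simpa only [IsSTerm, hG.one, hH.one] using IsTerm.root 0 1

lemma add (h : (ofRoots e e' emb emb').IsSTerm f g) (h' : (ofRoots e e' emb emb').IsSTerm f' g') :
    (ofRoots e e' emb emb').IsSTerm (fun γ => f γ + f' γ) (fun γ => g γ + g' γ) := by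
  simpa only [IsSTerm, hG.add, hH.add] using IsTerm.mul h h'

lemma neg (h : (ofRoots e e' emb emb').IsSTerm f g) :
    (ofRoots e e' emb emb').IsSTerm (fun γ => - f γ) (fun γ => - g γ) := by
  simpa only [IsSTerm, hG.neg, hH.neg] using IsTerm.inv h

lemma mul (h : (ofRoots e e' emb emb').IsSTerm f g) (h' : (ofRoots e e' emb emb').IsSTerm f' g') :
    (ofRoots e e' emb emb').IsSTerm (fun γ => f γ * f' γ) (fun γ => g γ * g' γ) := by
  simpa only [IsSTerm, hG.mul, hH.mul] using IsTerm.mulWord h h'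

lemma sum {k : ℕ} {f : Fin k → (α → G) × (β → K) → K} {g : Fin k → (α → H) × (β → L) → L}
    (h : ∀ i, (ofRoots e e' emb emb').IsSTerm (f i) (g i)) :
    (ofRoots e e' emb emb').IsSTerm (fun γ => ∑ i, f i γ) (fun γ => ∑ i, g i γ) := by
  induction k with
  | zero => simpa using zero hG hH
  | succ k ih =>
    simp only [Fin.sum_univ_succ]
    exact add hG hH (h 0) (ih fun i => h i.succ)

/-- Matrix entries are computed in the interpreted field, so equations between matrices over `F` and
`L` become formulas of the two groups. -/
lemma rootElement {n : ℕ} (h : (ofRoots e e' emb emb').IsSTerm f g) (i j r s : Fin n) :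
    (ofRoots e e' emb emb').IsSTerm (fun γ => (Matrix.rootElement i j (f γ)).1 r s)
      (fun γ => (Matrix.rootElement i j (g γ)).1 r s) := by
  have h1 : (ofRoots e e' emb emb').IsSTerm (α := α) (β := β)
      (fun _ => (1 : Matrix (Fin n) (Fin n) K) r s)
      (fun _ => (1 : Matrix (Fin n) (Fin n) L) r s) := by
    simp only [Matrix.one_apply]
    split_ifs
    exacts [one hG hH, zero hG hH]
  by_cases hij : i = j
  · simpa only [hij, Matrix.rootElement_self, Units.val_one] using h1
  · simp only [Matrix.coe_rootElement hij, Matrix.add_apply]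
    refine add hG hH h1 ?_
    simp only [Matrix.single_apply]
    split_ifs
    exacts [h, zero hG hH]

lemma listProd {n k : ℕ} {A : Fin k → (α → G) × (β → K) → Matrix.GeneralLinearGroup (Fin n) K}
    {B : Fin k → (α → H) × (β → L) → Matrix.GeneralLinearGroup (Fin n) L}
    (h : ∀ i r s, (ofRoots e e' emb emb').IsSTerm (fun γ => (A i γ).1 r s)
      (fun γ => (B i γ).1 r s)) (r s : Fin n) :
    (ofRoots e e' emb emb').IsSTerm (fun γ => (List.ofFn fun i => A i γ).prod.1 r s)
      (fun γ => (List.ofFn fun i => B i γ).prod.1 r s) := by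
  induction k generalizing r s with
  | zero =>
    simp only [List.ofFn_zero, List.prod_nil, Units.val_one, Matrix.one_apply]
    split_ifs
    exacts [one hG hH, zero hG hH]
  | succ k ih =>
    simp only [List.ofFn_succ, List.prod_cons, Units.val_mul, Matrix.mul_apply]
    exact sum hG hH fun t => mul hG hH (h 0 r t) (ih (fun i => h i.succ) t s)

end IsSTerm

end Frame

section Transfer

open Frame

variable {m : ℕ} {F H L : Type*} [Field F] [Group H] [Field L]
  {e : Fin (m + 3) → Fin (m + 3) → H} {emb : L → H}

/-- The statement that the elements `e i j` of `H` are not distinguished from the elementary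
transvections over `F` by formulas, and that they describe the field `L`. -/
structure IsTransfer (F : Type*) [Field F] (e : Fin (m + 3) → Fin (m + 3) → H) (emb : L → H) :
    Prop where
  isRootEmbedding : IsRootEmbedding e emb
  equivalent : (ofRoots (fun i j => Matrix.rootElement i j (1 : F)) e
    (Matrix.rootElement 0 1 : F → _) emb).Equivalent

namespace IsTransfer

variable (h : IsTransfer F e emb)
include h

lemma sorted : (ofRoots (fun i j => Matrix.rootElement i j (1 : F)) e
    (Matrix.rootElement 0 1 : F → _) emb).Sorted :=
  IsRootEmbedding.sorted Matrix.isRootEmbedding_rootElement h.isRootEmbedding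

/-- For a fixed shape `p`, `s`, one side is arithmetic in the interpreted field and the other a
product in the group. Their equivalence for all entries is one sentence, and over `F` the two
products coincide. -/
lemma prod_eq_one_iff {k : ℕ} (p : Fin k → Fin (m + 3) × Fin (m + 3)) (s : Fin k → Bool)
    (w : Fin k → L) :
    (List.ofFn fun i => cond (s i) (Matrix.rootElement (p i).1 (p i).2 (w i))
      (Matrix.rootElement (p i).1 (p i).2 (w i))⁻¹).prod = 1 ↔
    (List.ofFn fun i => cond (s i) (rootWord e (p i).1 (p i).2 (emb (w i)))
      (rootWord e (p i).1 (p i).2 (emb (w i)))⁻¹).prod = 1 := by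
  have hG := Matrix.isRootEmbedding_rootElement (m := m) (F := F)
  have hH := h.isRootEmbedding
  refine (h.equivalent.iff (Definable.allSTuple h.sorted (κ := Fin k) (P := fun _ w =>
    ((List.ofFn fun i => cond (s i) (Matrix.rootElement (p i).1 (p i).2 (w i))
      (Matrix.rootElement (p i).1 (p i).2 (w i))⁻¹).prod = 1 ↔
    (List.ofFn fun i => cond (s i) (rootWord (fun i j => Matrix.rootElement i j 1) (p i).1 (p i).2
      (Matrix.rootElement 0 1 (w i))) (rootWord (fun i j => Matrix.rootElement i j 1) (p i).1
      (p i).2 (Matrix.rootElement 0 1 (w i)))⁻¹).prod = 1)) (Q := fun _ w =>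
    ((List.ofFn fun i => cond (s i) (Matrix.rootElement (p i).1 (p i).2 (w i))
      (Matrix.rootElement (p i).1 (p i).2 (w i))⁻¹).prod = 1 ↔
    (List.ofFn fun i => cond (s i) (rootWord e (p i).1 (p i).2 (emb (w i)))
      (rootWord e (p i).1 (p i).2 (emb (w i)))⁻¹).prod = 1)) (Definable.iff ?_ ?_))).1 ?_ w
  · simp only [Units.ext_iff, ← Matrix.ext_iff]
    refine Definable.all fun a => Definable.all fun b => Definable.sEq h.sorted.injG h.sorted.injH
      (IsSTerm.listProd hG hH (fun i a b => ?_) a b) ?_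
    · cases s i
      · simp only [cond_false, ← Matrix.rootElement_neg]
        exact IsSTerm.rootElement hG hH (IsSTerm.neg hG hH (IsSTerm.var _)) _ _ _ _
      · exact IsSTerm.rootElement hG hH (IsSTerm.var _) _ _ _ _
    · simp only [Units.val_one, Matrix.one_apply]
      split_ifs
      exacts [IsSTerm.one hG hH, IsSTerm.zero hG hH]
  · refine Definable.eq (IsTerm.listProd fun i => ?_) IsTerm.one
    cases s i
    exacts [(IsTerm.rootWord _ _ (IsSTerm.var _)).inv, IsTerm.rootWord _ _ (IsSTerm.var _)]
  · intro w
    simp only [Matrix.rootWord_rootElement]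

lemma ker_matrixHom : (matrixHom (m := m) L).ker = (wordHom e emb).ker := by
  ext x
  rw [MonoidHom.mem_ker, MonoidHom.mem_ker]
  obtain ⟨l, rfl⟩ := Quot.exists_rep x
  change matrixHom L (FreeGroup.mk l) = 1 ↔ wordHom e emb (FreeGroup.mk l) = 1
  rw [matrixHom, wordHom, FreeGroup.lift_mk, FreeGroup.lift_mk, ← List.ofFn_get l, List.map_ofFn,
    List.map_ofFn]
  exact h.prod_eq_one_iff _ _ _

/-- Commutators in `GL_n(F)` have determinant one, and the uniform number of factors makes the
statement first-order. -/
lemma exists_commutator (x y : H) : ∃ (p : Fin (Matrix.transvectionBound (m + 3)) →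
    Fin (m + 3) × Fin (m + 3)) (w : Fin (Matrix.transvectionBound (m + 3)) → L),
    ⁅x, y⁆ = (List.ofFn fun i => rootWord e (p i).1 (p i).2 (emb (w i))).prod := by
  refine (h.equivalent.iff (Definable.forallG (P := fun _ x => ∀ y,
    ∃ p : Fin (Matrix.transvectionBound (m + 3)) → Fin (m + 3) × Fin (m + 3),
    ∃ w : Fin (Matrix.transvectionBound (m + 3)) → F, ⁅x, y⁆ = (List.ofFn fun i =>
      rootWord (fun i j => Matrix.rootElement i j 1) (p i).1 (p i).2
      (Matrix.rootElement 0 1 (w i))).prod)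
    (Q := fun _ x => ∀ y,
    ∃ p : Fin (Matrix.transvectionBound (m + 3)) → Fin (m + 3) × Fin (m + 3),
    ∃ w : Fin (Matrix.transvectionBound (m + 3)) → L,
    ⁅x, y⁆ = (List.ofFn fun i => rootWord e (p i).1 (p i).2 (emb (w i))).prod)
    (Definable.forallG (Definable.ex fun p => Definable.exSTuple h.sorted
    (Definable.eq ((IsTerm.var (Sum.inl (Sum.inr ()))).commutator (IsTerm.var (Sum.inr ())))
    (IsTerm.listProd fun i => IsTerm.rootWord _ _ (IsSTerm.var (Sum.inr i)))))))).1 ?_ x y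
  intro x y
  simp only [Matrix.rootWord_rootElement]
  exact Matrix.exists_list_rootElement ⁅x, y⁆ (by
    change (Units.map Matrix.detMonoidHom ⁅x, y⁆).1 = 1
    rw [map_commutatorElement, commutatorElement_eq_one_iff_commute.2 (Commute.all _ _)]
    rfl)

lemma exists_rootWord_eq_commutator (i j : Fin (m + 3)) (a : L) :
    ∃ x y : H, rootWord e i j (emb a) = ⁅x, y⁆ := by
  refine (h.equivalent.iff (Definable.forallS h.sorted
    (P := fun _ a => ∃ x y, rootWord (fun i j => Matrix.rootElement i j 1) i j
      (Matrix.rootElement 0 1 a) = ⁅x, y⁆)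
    (Q := fun _ a => ∃ x y, rootWord e i j (emb a) = ⁅x, y⁆)
    (Definable.existsG (Definable.existsG (Definable.eq
      (IsTerm.rootWord _ _ (IsSTerm.var (Sum.inr ())))
      ((IsTerm.var (Sum.inl (Sum.inr ()))).commutator (IsTerm.var (Sum.inr ())))))))).1 ?_ a
  intro a
  simp only [Matrix.rootWord_rootElement]
  by_cases hij : i = j
  · exact ⟨1, 1, by rw [hij, Matrix.rootElement_self, commutatorElement_one_left]⟩
  · obtain ⟨k, hki, hkj⟩ : ∃ k, k ≠ i ∧ k ≠ j := exists_ne_ne_of_two_lt_card (by simp) i j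
    exact ⟨_, _, by rw [Matrix.commutator_rootElement hki.symm hkj hij a 1, mul_one]⟩

/-- The derived subgroup consists of products of commutators of unbounded number; only the
generators on each side are transferred, and the generated subgroups are then compared. -/
lemma range_wordHom : (wordHom e emb).range = commutator H := by
  apply le_antisymm
  · refine FreeGroup.range_lift_le ?_
    rintro _ ⟨t, rfl⟩
    obtain ⟨x, y, hxy⟩ := h.exists_rootWord_eq_commutator t.1.1 t.1.2 t.2
    change rootWord e t.1.1 t.1.2 (emb t.2) ∈ _
    rw [hxy]
    exact Subgroup.commutator_mem_commutator trivial trivial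
  · rw [commutator_def, Subgroup.commutator_le]
    intro x _ y _
    obtain ⟨p, w, hpw⟩ := h.exists_commutator x y
    rw [hpw]
    refine Subgroup.list_prod_mem _ fun x hx => ?_
    obtain ⟨k, rfl⟩ := (List.mem_ofFn' _ _).1 hx
    exact ⟨FreeGroup.of (p k, w k), FreeGroup.lift_apply_of⟩

/-- Both groups are images of one free group under homomorphisms with the same kernel. -/
theorem nonempty_commutator_mulEquiv :
    Nonempty (commutator H ≃* Matrix.SpecialLinearGroup (Fin (m + 3)) L) :=
  ⟨(MulEquiv.subgroupCongr h.range_wordHom.symm).trans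
    ((QuotientGroup.quotientKerEquivRange (wordHom e emb)).symm.trans
    ((QuotientGroup.quotientMulEquivOfEq h.ker_matrixHom.symm).trans
    ((QuotientGroup.quotientKerEquivRange (matrixHom L)).trans
    ((MulEquiv.subgroupCongr (range_matrixHom L)).trans
    (MonoidHom.ofInjective Matrix.SpecialLinearGroup.toGL_injective).symm))))⟩

end IsTransfer

end Transfer

/-! ### The determinant modulo `n`-th powers -/

section Words

variable {m : ℕ} {K G : Type*} [Group G] (e : Fin (m + 3) → Fin (m + 3) → G) (emb : K → G)

/-- The group-theoretic description of the matrices of determinant one. -/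
def IsRootProduct (x : G) : Prop :=
  ∃ (p : Fin (Matrix.transvectionBound (m + 3)) → Fin (m + 3) × Fin (m + 3))
    (w : Fin (Matrix.transvectionBound (m + 3)) → K),
    x = (List.ofFn fun i => rootWord e (p i).1 (p i).2 (emb (w i))).prod

/-- The group-theoretic description of the pairs of a matrix and the element at position `(0, 1)`
whose entry is the determinant up to powers. -/
def DetRel (x a : G) : Prop :=
  ∃ d, (∀ i j, i ≠ 0 → j ≠ 0 → d * e i j = e i j * d) ∧ d * e 0 1 = a * d ∧
    IsRootProduct e emb (d⁻¹ * x)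

end Words

namespace Matrix

variable {m : ℕ} {F : Type*} [Field F]

lemma isRootProduct_iff (x : GeneralLinearGroup (Fin (m + 3)) F) :
    IsRootProduct (fun i j => rootElement i j (1 : F)) (rootElement 0 1 : F → _) x ↔
      GeneralLinearGroup.det x = 1 := by
  simp only [IsRootProduct, rootWord_rootElement]
  constructor
  · rintro ⟨p, w, rfl⟩
    rw [map_list_prod, List.map_ofFn]
    refine List.prod_eq_one fun y hy => ?_
    obtain ⟨k, rfl⟩ := (List.mem_ofFn' _ _).1 hy
    exact Units.ext (det_rootElement _ _ _)
  · exact fun h => exists_list_rootElement x (congrArg Units.val h)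

lemma exists_generalLinearGroup_diagonal (u l : Fˣ) :
    ∃ d : GeneralLinearGroup (Fin (m + 3)) F,
      d.1 = diagonal (fun i => if i = 0 then (u : F) else l) ∧
      GeneralLinearGroup.det d = u * l ^ (m + 2) := by
  have h : (diagonal (fun i : Fin (m + 3) => if i = 0 then (u : F) else l)).det =
      (u * l ^ (m + 2) : Fˣ) := by
    simp [det_diagonal, Fin.prod_univ_succ (n := m + 2)]
  exact ⟨GeneralLinearGroup.mkOfDetNeZero _ (h ▸ Units.ne_zero _), rfl, Units.ext h⟩

lemma eq_diagonal_of_commute_rootElement {d : GeneralLinearGroup (Fin (m + 3)) F}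
    (hd : ∀ i j, i ≠ 0 → j ≠ 0 → d * rootElement i j 1 = rootElement i j 1 * d) :
    d.1 = diagonal (fun i => if i = 0 then d.1 0 0 else d.1 1 1) := by
  have h3 (i j : Fin (m + 3)) : ∃ k, k ≠ i ∧ k ≠ j := exists_ne_ne_of_two_lt_card (by simp) i j
  have hc (k l : Fin (m + 3)) (hk : k ≠ 0) (hl : l ≠ 0) (hkl : k ≠ l) :
      Commute (single k l 1) d.1 :=
    ((commute_rootElement_one_iff hkl d).1 (hd k l hk hl)).symm
  ext r s
  by_cases hrs : r = s
  · subst hrs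
    rw [diagonal_apply_eq]
    split_ifs with h0
    · rw [h0]
    · by_cases h1 : r = 1
      · rw [h1]
      · exact diag_eq_of_commute_single (hc r 1 h0 (by simp) h1)
  · rw [diagonal_apply_ne _ hrs]
    by_cases hs : s = 0
    · obtain ⟨k, hk0, hkr⟩ := h3 0 r
      exact row_eq_zero_of_commute_single (hc k r hk0 (hs ▸ hrs) hkr) (Ne.symm hrs)
    · obtain ⟨k, hk0, hks⟩ := h3 0 s
      exact col_eq_zero_of_commute_single (hc s k hs hk0 hks.symm) hrs

lemma diagonal_mul_rootElement_iff {d : GeneralLinearGroup (Fin (m + 3)) F} {u l : F}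
    (hd : d.1 = diagonal (fun i => if i = 0 then u else l)) (a : F) :
    d * rootElement 0 1 1 = rootElement 0 1 a * d ↔ u = a * l := by
  have h01 : (0 : Fin (m + 3)) ≠ 1 := by simp
  rw [← Units.val_inj, Units.val_mul, Units.val_mul, coe_rootElement h01, coe_rootElement h01,
    mul_add, add_mul, mul_one, one_mul, add_right_inj, hd]
  refine ⟨fun h => by simpa using congrFun (congrFun h 0) 1, fun h => ?_⟩
  ext r s
  simp only [diagonal_mul, mul_diagonal, single_apply]
  grind

/-- The witness is `d = diag(u, l, ..., l)`, and the action on `e 0 1` says `u = a * l`. Since `d⁻¹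
* x` has determinant one, the determinant of `x` is `a * l ^ n`. -/
lemma detRel_iff (x : GeneralLinearGroup (Fin (m + 3)) F) (a : F) :
    DetRel (fun i j => rootElement i j (1 : F)) (rootElement 0 1 : F → _) x (rootElement 0 1 a) ↔
      ∃ l : Fˣ, (GeneralLinearGroup.det x : F) = a * l ^ (m + 3) := by
  simp only [DetRel, isRootProduct_iff, map_mul, map_inv, inv_mul_eq_one]
  constructor
  · rintro ⟨d, hd, hda, hx⟩
    have hd' := eq_diagonal_of_commute_rootElement hd
    rw [diagonal_mul_rootElement_iff hd'] at hda
    have hdet : (GeneralLinearGroup.det d : F) = d.1 0 0 * d.1 1 1 ^ (m + 2) := by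
      change d.1.det = _
      rw [hd']
      simp [det_diagonal, Fin.prod_univ_succ (n := m + 2)]
    have h0 : d.1 1 1 ≠ 0 := fun h0 => by
      rw [h0, zero_pow (by omega), mul_zero] at hdet
      exact Units.ne_zero _ hdet
    refine ⟨Units.mk0 _ h0, ?_⟩
    rw [← hx, hdet, hda, Units.val_mk0]
    ring
  · rintro ⟨l, hl⟩
    have ha : a ≠ 0 := fun h => Units.ne_zero (GeneralLinearGroup.det x) (by rw [hl, h, zero_mul])
    obtain ⟨d, hd, hdet⟩ := exists_generalLinearGroup_diagonal (m := m) (Units.mk0 a ha * l) l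
    refine ⟨d, fun i j hi hj => ?_, ?_, ?_⟩
    · by_cases hij : i = j
      · rw [hij, rootElement_self, mul_one, one_mul]
      · rw [commute_rootElement_one_iff hij, hd]
        ext r s
        simp only [diagonal_mul, mul_diagonal, single_apply]
        grind
    · rw [diagonal_mul_rootElement_iff hd, Units.val_mul, Units.val_mk0]
    · ext1
      rw [hdet, hl]
      push_cast
      rw [Units.val_mk0]
      ring

end Matrix

namespace Frame

variable {m : ℕ} {G H : Type*} [Group G] [Group H] {K L : Type*}
variable {e : Fin (m + 3) → Fin (m + 3) → G} {e' : Fin (m + 3) → Fin (m + 3) → H}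
  {emb : K → G} {emb' : L → H} {α β : Type}
  {f f' : (α → G) × (β → K) → G} {g g' : (α → H) × (β → L) → H}

namespace Definable

lemma isRootProduct (hS : (ofRoots e e' emb emb').Sorted)
    (h : (ofRoots e e' emb emb').IsTerm f g) :
    (ofRoots e e' emb emb').Definable (fun γ => IsRootProduct e emb (f γ))
      (fun γ => IsRootProduct e' emb' (g γ)) :=
  ex fun _ => exSTuple hS (eq (h.relabel id Sum.inl)
    (IsTerm.listProd fun i => IsTerm.rootWord _ _ (IsSTerm.var (Sum.inr i))))

lemma detRel (hS : (ofRoots e e' emb emb').Sorted) (h : (ofRoots e e' emb emb').IsTerm f g)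
    (h' : (ofRoots e e' emb emb').IsTerm f' g') :
    (ofRoots e e' emb emb').Definable (fun γ => DetRel e emb (f γ) (f' γ))
      (fun γ => DetRel e' emb' (g γ) (g' γ)) :=
  existsG (((all fun i : Fin (m + 3) => all fun j : Fin (m + 3) => (prop _).imp ((prop _).imp
    (eq ((IsTerm.var _).mul (IsTerm.root i j)) ((IsTerm.root i j).mul (IsTerm.var _)))))).and
    ((eq ((IsTerm.var _).mul (IsTerm.root 0 1)) ((h'.relabel Sum.inl id).mul (IsTerm.var _))).and
    (isRootProduct hS ((IsTerm.var (Sum.inr ())).inv.mul (h.relabel Sum.inl id)))))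

end Definable

end Frame

open Frame in
lemma Frame.IsSTerm.pow {m : ℕ} {G H : Type*} [Group G] [Group H] {K L : Type*} [Field K] [Field L]
    {e : Fin (m + 3) → Fin (m + 3) → G} {e' : Fin (m + 3) → Fin (m + 3) → H}
    {emb : K → G} {emb' : L → H} {α β : Type} (hG : IsRootEmbedding e emb)
    (hH : IsRootEmbedding e' emb') {f : (α → G) × (β → K) → K} {g : (α → H) × (β → L) → L}
    (h : (ofRoots e e' emb emb').IsSTerm f g) (k : ℕ) :
    (ofRoots e e' emb emb').IsSTerm (fun γ => f γ ^ k) (fun γ => g γ ^ k) := by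
  induction k with
  | zero => simpa using one hG hH
  | succ k ih => simpa only [pow_succ] using mul hG hH ih h

namespace IsTransfer

open Frame

variable {m : ℕ} {F H L : Type*} [Field F] [Group H] [Field L]
  {e : Fin (m + 3) → Fin (m + 3) → H} {emb : L → H} (h : IsTransfer F e emb)
include h

lemma exists_detRel (x : H) : ∃ a, DetRel e emb x (emb a) := by
  refine (h.equivalent.iff (Definable.forallG (P := fun _ x => ∃ a,
    DetRel (fun i j => Matrix.rootElement i j 1) (Matrix.rootElement 0 1) x
      (Matrix.rootElement 0 1 a)) (Q := fun _ x => ∃ a, DetRel e emb x (emb a))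
    (Definable.existsS h.sorted (Definable.detRel h.sorted (IsTerm.var (Sum.inr ()))
      (IsSTerm.var (Sum.inr ())))))).1 ?_ x
  intro x
  simp only [Matrix.detRel_iff]
  exact ⟨Matrix.GeneralLinearGroup.det x, 1, by simp⟩

lemma detRel_ne_zero {x : H} {a : L} (hx : DetRel e emb x (emb a)) : a ≠ 0 := by
  refine (h.equivalent.iff (Definable.forallG (P := fun _ x => ∀ a,
    DetRel (fun i j => Matrix.rootElement i j 1) (Matrix.rootElement 0 1) x
      (Matrix.rootElement 0 1 a) → a ≠ 0)
    (Q := fun _ x => ∀ a, DetRel e emb x (emb a) → a ≠ 0)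
    (Definable.forallS h.sorted ((Definable.detRel h.sorted (IsTerm.var (Sum.inr ()))
      (IsSTerm.var (Sum.inr ()))).imp (Definable.sEq h.sorted.injG h.sorted.injH (IsSTerm.var _)
      (IsSTerm.zero Matrix.isRootEmbedding_rootElement h.isRootEmbedding)).not)))).1 ?_ x a hx
  intro x a
  simp only [Matrix.detRel_iff]
  rintro ⟨l, hl⟩ rfl
  exact Units.ne_zero _ (hl.trans (zero_mul _))

lemma detRel_mul {x y : H} {a b : L} (hx : DetRel e emb x (emb a)) (hy : DetRel e emb y (emb b)) :
    DetRel e emb (x * y) (emb (a * b)) := by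
  refine (h.equivalent.iff (Definable.forallG (P := fun _ x => ∀ y, ∀ a b,
    DetRel (fun i j => Matrix.rootElement i j 1) (Matrix.rootElement 0 1) x
      (Matrix.rootElement 0 1 a) →
    DetRel (fun i j => Matrix.rootElement i j 1) (Matrix.rootElement 0 1) y
      (Matrix.rootElement 0 1 b) →
    DetRel (fun i j => Matrix.rootElement i j 1) (Matrix.rootElement 0 1) (x * y)
      (Matrix.rootElement 0 1 (a * b)))
    (Q := fun _ x => ∀ y, ∀ a b, DetRel e emb x (emb a) → DetRel e emb y (emb b) →
      DetRel e emb (x * y) (emb (a * b)))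
    (Definable.forallG (Definable.forallS h.sorted (Definable.forallS h.sorted
    ((Definable.detRel h.sorted (IsTerm.var (Sum.inl (Sum.inr ())))
      (IsSTerm.var (Sum.inl (Sum.inr ())))).imp
    ((Definable.detRel h.sorted (IsTerm.var (Sum.inr ())) (IsSTerm.var (Sum.inr ()))).imp
    (Definable.detRel h.sorted ((IsTerm.var (Sum.inl (Sum.inr ()))).mul (IsTerm.var (Sum.inr ())))
      (IsSTerm.mul Matrix.isRootEmbedding_rootElement h.isRootEmbedding
        (IsSTerm.var (Sum.inl (Sum.inr ()))) (IsSTerm.var (Sum.inr ()))))))))))).1 ?_ x y a b hx hy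
  intro x y a b
  simp only [Matrix.detRel_iff]
  rintro ⟨l, hl⟩ ⟨k, hk⟩
  refine ⟨l * k, ?_⟩
  rw [map_mul, Units.val_mul, Units.val_mul, hl, hk]
  ring

lemma exists_eq_mul_pow {x : H} {a b : L} (ha : DetRel e emb x (emb a))
    (hb : DetRel e emb x (emb b)) : ∃ c, a = b * c ^ (m + 3) := by
  refine (h.equivalent.iff (Definable.forallG (P := fun _ x => ∀ a b,
    DetRel (fun i j => Matrix.rootElement i j 1) (Matrix.rootElement 0 1) x
      (Matrix.rootElement 0 1 a) →
    DetRel (fun i j => Matrix.rootElement i j 1) (Matrix.rootElement 0 1) x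
      (Matrix.rootElement 0 1 b) → ∃ c, a = b * c ^ (m + 3))
    (Q := fun _ x => ∀ a b, DetRel e emb x (emb a) → DetRel e emb x (emb b) →
      ∃ c, a = b * c ^ (m + 3))
    (Definable.forallS h.sorted (Definable.forallS h.sorted
    ((Definable.detRel h.sorted (IsTerm.var (Sum.inr ()))
      (IsSTerm.var (Sum.inl (Sum.inr ())))).imp
    ((Definable.detRel h.sorted (IsTerm.var (Sum.inr ())) (IsSTerm.var (Sum.inr ()))).imp
    (Definable.existsS h.sorted (Definable.sEq h.sorted.injG h.sorted.injH
      (IsSTerm.var (Sum.inl (Sum.inl (Sum.inr ()))))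
      (IsSTerm.mul Matrix.isRootEmbedding_rootElement h.isRootEmbedding
        (IsSTerm.var (Sum.inl (Sum.inr ()))) (IsSTerm.pow Matrix.isRootEmbedding_rootElement
        h.isRootEmbedding (IsSTerm.var (Sum.inr ())) _)))))))))).1 ?_ x a b ha hb
  intro x a b
  simp only [Matrix.detRel_iff]
  rintro ⟨l, hl⟩ ⟨k, hk⟩
  refine ⟨k / l, ?_⟩
  rw [div_pow, ← mul_div_assoc, ← hk, hl, mul_div_cancel_right₀ _ (pow_ne_zero _ l.ne_zero)]

lemma exists_detRel_of_ne_zero {a : L} (ha : a ≠ 0) : ∃ x, DetRel e emb x (emb a) := by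
  refine (h.equivalent.iff (Definable.forallS h.sorted (P := fun _ a => a ≠ 0 → ∃ x,
    DetRel (fun i j => Matrix.rootElement i j 1) (Matrix.rootElement 0 1) x
      (Matrix.rootElement 0 1 a))
    (Q := fun _ a => a ≠ 0 → ∃ x, DetRel e emb x (emb a))
    ((Definable.sEq h.sorted.injG h.sorted.injH (IsSTerm.var _)
      (IsSTerm.zero Matrix.isRootEmbedding_rootElement h.isRootEmbedding)).not.imp
    (Definable.existsG (Definable.detRel h.sorted (IsTerm.var (Sum.inr ()))
      (IsSTerm.var (Sum.inr ()))))))).1 ?_ a ha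
  intro a ha
  simp only [Matrix.detRel_iff]
  obtain ⟨x, hx⟩ := Matrix.GeneralLinearGroup.det_surjective (n := Fin (m + 3)) (Units.mk0 a ha)
  exact ⟨x, 1, by simp [hx]⟩

/-- Over `F` both sides say that the determinant is an `n`-th power of a unit, because scalar
matrices have exactly these determinants. The right side will identify the kernel. -/
lemma exists_detRel_pow_iff (x : H) : (∃ c, DetRel e emb x (emb (c ^ (m + 3)))) ↔
    ∃ z, (∀ y, y * z = z * y) ∧ IsRootProduct e emb (z⁻¹ * x) := by
  refine (h.equivalent.iff (Definable.forallG (P := fun _ x => (∃ c,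
    DetRel (fun i j => Matrix.rootElement i j 1) (Matrix.rootElement 0 1) x
      (Matrix.rootElement 0 1 (c ^ (m + 3)))) ↔ ∃ z, (∀ y, y * z = z * y) ∧
      IsRootProduct (fun i j => Matrix.rootElement i j 1) (Matrix.rootElement 0 1 : F → _)
        (z⁻¹ * x))
    (Q := fun _ x => (∃ c, DetRel e emb x (emb (c ^ (m + 3)))) ↔
      ∃ z, (∀ y, y * z = z * y) ∧ IsRootProduct e emb (z⁻¹ * x))
    (Definable.iff (Definable.existsS h.sorted (Definable.detRel h.sorted
      (IsTerm.var (Sum.inr ())) (IsSTerm.pow Matrix.isRootEmbedding_rootElement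
        h.isRootEmbedding (IsSTerm.var (Sum.inr ())) _)))
    (Definable.existsG (Definable.and (Definable.forallG (Definable.eq
      ((IsTerm.var (Sum.inr ())).mul (IsTerm.var (Sum.inl (Sum.inr ()))))
      ((IsTerm.var (Sum.inl (Sum.inr ()))).mul (IsTerm.var (Sum.inr ())))))
      (Definable.isRootProduct h.sorted ((IsTerm.var (Sum.inr ())).inv.mul
      (IsTerm.var (Sum.inl (Sum.inr ())))))))))).1 ?_ x
  intro x
  simp only [Matrix.detRel_iff, Matrix.isRootProduct_iff, map_mul, map_inv, inv_mul_eq_one,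
    ← Subgroup.mem_center_iff, Matrix.GeneralLinearGroup.center_eq_range_scalar]
  constructor
  · rintro ⟨c, l, hl⟩
    have hc : c ≠ 0 := fun hc => Units.ne_zero (Matrix.GeneralLinearGroup.det x) (by
      rw [hl, hc, zero_pow (by omega), zero_mul])
    refine ⟨_, ⟨Units.mk0 c hc * l, rfl⟩, Units.ext ?_⟩
    rw [Matrix.GeneralLinearGroup.det_scalar, hl, Fintype.card_fin]
    simp [mul_pow]
  · rintro ⟨_, ⟨l, rfl⟩, hl⟩
    exact ⟨1, l, by rw [← hl]; simp⟩

/-- The determinant up to powers. -/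
theorem exists_monoidHom : ∃ π : H →* Lˣ ⧸ (powMonoidHom (m + 3) : Lˣ →* Lˣ).range,
    Function.Surjective π ∧ π.ker = commutator H ⊔ Subgroup.center H := by
  choose a ha using h.exists_detRel
  have ha0 (x : H) : a x ≠ 0 := h.detRel_ne_zero (ha x)
  -- The class of `a x` does not depend on the choice, so multiplicativity of `DetRel` makes the map
  -- a homomorphism.
  have key {x : H} {b : L} (hb0 : b ≠ 0) (hb : DetRel e emb x (emb b)) :
      (Units.mk0 (a x) (ha0 x) : Lˣ ⧸ (powMonoidHom (m + 3) : Lˣ →* Lˣ).range) =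
        (Units.mk0 b hb0 : Lˣ) := by
    obtain ⟨c, hc⟩ := h.exists_eq_mul_pow hb (ha x)
    have hc0 : c ≠ 0 := by
      rintro rfl
      exact hb0 (by rw [hc, zero_pow (by omega), mul_zero])
    refine QuotientGroup.eq.2 ⟨Units.mk0 c hc0, ?_⟩
    rw [eq_inv_mul_iff_mul_eq]
    ext
    simp [hc]
  let π : H →* Lˣ ⧸ (powMonoidHom (m + 3) : Lˣ →* Lˣ).range :=
    MonoidHom.mk' (fun x => (Units.mk0 (a x) (ha0 x) : Lˣ)) fun x y => by
      rw [key (mul_ne_zero (ha0 x) (ha0 y)) (h.detRel_mul (ha x) (ha y)), Units.mk0_mul]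
      rfl
  have hker (x : H) : x ∈ π.ker ↔ ∃ c, DetRel e emb x (emb (c ^ (m + 3))) := by
    rw [MonoidHom.mem_ker]
    constructor
    · intro hx
      obtain ⟨c, hc⟩ := (QuotientGroup.eq_one_iff _).1 hx
      refine ⟨c, ?_⟩
      have : (c : L) ^ (m + 3) = a x := congrArg Units.val hc
      exact this ▸ ha x
    · rintro ⟨c, hc⟩
      have hc0 : c ≠ 0 := by
        rintro rfl
        exact h.detRel_ne_zero hc (zero_pow (by omega))
      refine (key (pow_ne_zero _ hc0) hc).trans ((QuotientGroup.eq_one_iff _).2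
        ⟨Units.mk0 c hc0, Units.ext rfl⟩)
  refine ⟨π, fun q => ?_, le_antisymm (fun x hx => ?_) (sup_le ?_ fun z hz => ?_)⟩
  · obtain ⟨b, rfl⟩ := QuotientGroup.mk_surjective q
    obtain ⟨x, hx⟩ := h.exists_detRel_of_ne_zero b.ne_zero
    exact ⟨x, (key b.ne_zero hx).trans (by rw [Units.mk0_val])⟩
  · obtain ⟨z, hz, p, w, hw⟩ := (h.exists_detRel_pow_iff x).1 ((hker x).1 hx)
    rw [inv_mul_eq_iff_eq_mul] at hw
    rw [hw, sup_comm, ← h.range_wordHom]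
    refine Subgroup.mul_mem_sup (Subgroup.mem_center_iff.2 hz) (Subgroup.list_prod_mem _ ?_)
    intro y hy
    obtain ⟨k, rfl⟩ := (List.mem_ofFn' _ _).1 hy
    exact ⟨FreeGroup.of (p k, w k), FreeGroup.lift_apply_of⟩
  · rw [commutator_def, Subgroup.commutator_le]
    intro x _ y _
    rw [MonoidHom.mem_ker, map_commutatorElement, commutatorElement_eq_one_iff_mul_comm]
    exact congrArg QuotientGroup.mk (mul_comm (Units.mk0 (a x) (ha0 x)) (Units.mk0 (a y) (ha0 y)))
  -- The identity is the empty-like product of words at position `(0, 0)`, which are trivial by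
  -- convention.
  · refine (hker z).2 ((h.exists_detRel_pow_iff z).2 ⟨z, Subgroup.mem_center_iff.1 hz,
      fun _ => (0, 0), fun _ => 0, ?_⟩)
    rw [inv_mul_cancel, eq_comm]
    refine List.prod_eq_one fun y hy => ?_
    obtain ⟨k, rfl⟩ := (List.mem_ofFn' _ _).1 hy
    exact if_pos rfl

end IsTransfer

/-! ### The center -/

namespace GroupElemEquiv

open Frame

/-- The center is defined by the same formula in both groups, and its operations are restrictions of
those of the group. -/
lemma center {G H : Type*} [Group G] [Group H] (h : GroupElemEquiv G H) :
    GroupElemEquiv (Subgroup.center G) (Subgroup.center H) := by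
  let S : Frame G H Empty (Subgroup.center G) (Subgroup.center H) :=
    ⟨Empty.elim, Empty.elim, Subtype.val, Subtype.val⟩
  have hE : S.Equivalent := fun φ => by
    refine Iff.trans ?_ ((elementarilyEquivalent_iff.1 h φ).trans ?_) <;>
    · refine iff_of_eq ?_
      unfold Sentence.Realize
      congr 1
      exact Subsingleton.elim _ _
  have hS : S.Sorted := ⟨Subtype.val_injective, Subtype.val_injective,
    (Definable.forallG (P := fun γ y => y * γ.1 () = γ.1 () * y)
      (Q := fun γ y => y * γ.1 () = γ.1 () * y) (Definable.eq
      ((IsTerm.var (Sum.inr ())).mul (IsTerm.var (Sum.inl ())))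
      ((IsTerm.var (Sum.inl ())).mul (IsTerm.var (Sum.inr ()))))).congr
    (fun γ => by simp [S, Subgroup.mem_center_iff]) (fun γ => by simp [S, Subgroup.mem_center_iff])⟩
  refine elementarilyEquivalent hE hS (fun _ => inferInstanceAs (IsEmpty Empty)) fun k f => ?_
  cases f with
  | mul => exact IsTerm.mul (IsSTerm.var (S := S) 0) (IsSTerm.var 1)
  | inv => exact IsTerm.inv (IsSTerm.var (S := S) 0)
  | one => exact IsTerm.one

lemma of_mulEquiv {G H : Type*} [Group G] [Group H] (θ : G ≃* H) : GroupElemEquiv G H :=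
  StrongHomClass.elementarilyEquivalent θ.toLanguageEquiv

lemma trans {G H K : Type*} [Group G] [Group H] [Group K] (h : GroupElemEquiv G H)
    (h' : GroupElemEquiv H K) : GroupElemEquiv G K :=
  Eq.trans h h'

end GroupElemEquiv

lemma Matrix.nonempty_center_mulEquiv (n : ℕ) [NeZero n] (F : Type*) [Field F] :
    Nonempty (Subgroup.center (GeneralLinearGroup (Fin n) F) ≃* Fˣ) := by
  have hinj : Function.Injective (GeneralLinearGroup.scalar (Fin n) :
      Fˣ →* GeneralLinearGroup (Fin n) F) := fun a b hab => by
    ext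
    simpa using congrArg (fun g : GeneralLinearGroup (Fin n) F => g.1 0 0) hab
  exact ⟨(MulEquiv.subgroupCongr GeneralLinearGroup.center_eq_range_scalar).trans
    (MonoidHom.ofInjective hinj).symm⟩

theorem theoremA4 (n : ℕ) (hn : 3 ≤ n) (F : Type u) [Field F]
    (H : Type v) [Group H]
    (hH : GroupElemEquiv H (Matrix.GeneralLinearGroup (Fin n) F)) :
    (∃ (L : Type v) (_ : Field L),
      FieldElemEquiv L F ∧
      Nonempty (commutator H ≃* Matrix.SpecialLinearGroup (Fin n) L) ∧
      ∃ π : H →* Lˣ ⧸ (powMonoidHom n : Lˣ →* Lˣ).range,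
        Function.Surjective π ∧ π.ker = commutator H ⊔ Subgroup.center H) ∧
    GroupElemEquiv (Subgroup.center H) Fˣ := by
  obtain ⟨m, rfl⟩ := Nat.exists_eq_add_of_le' hn
  refine ⟨?_, hH.center.trans (.of_mulEquiv (Matrix.nonempty_center_mulEquiv (m + 3) F).some)⟩
  obtain ⟨e, he⟩ := hH.exists_rootFrame hn
  obtain ⟨L, hL, emb, hemb, hLF⟩ :=
    Frame.exists_field Matrix.isRootEmbedding_rootElement (e' := e) he
  -- Equivalence of frames concerns the constants only, so `he` serves for the new embedding as
  -- well.
  have h : IsTransfer F e emb := ⟨hemb, he⟩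
  exact ⟨L, hL, hLF, h.nonempty_commutator_mulEquiv, h.exists_monoidHom⟩
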